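/- Let $m$ be a positive integer, let $\gamma_1,\gamma_2>0$ and $K$ be real numbers, and let $0<\delta<7/2$ and $A\ge 14/\delta$. Then there is a constant $C$, depending only on $m,\gamma_1,\gamma_2,K,\delta,A$, with the following property. Let $N\ge 16$ and $\sigma_L$ be real numbers with $1/2\le\sigma_L<1$ and $\delta<7(1-\sigma_L)$. For each prime $p$ let $c_1(p),\dots,c_m(p)$ be complex numbers with $|c_j(p)|\le 1$, and write $s=\sigma+it$. Let $L$ be a function given for $\sigma>1$ by the Euler product $$L(s)=\prod_{p}\prod_{j=1}^m\bigl(1-c_j(p)p^{-s}\bigr)^{-1},$$ and assume that 1. $L$ continues to a holomorphic function on (a neighbourhood of) the closed half plane $\sigma\ge\sigma_L$; 2. $L(s)\neq 0$ whenever $\sigma\ge 1$, and whenever $1-\delta/7\le\sigma<1$ and $|t|\le 2(\log N)^3$; 3. $|L(s)|\le K\,N^{\gamma_1}(1+|t|)^{\gamma_2}$ for $\sigma_L<\sigma<4$. Then $$L(1)=(1+E)\prod_{p\le(\log N)^A}\prod_{j=1}^m\bigl(1-c_j(p)p^{-1}\bigr)^{-1}\qquad\text{with}\qquad |E|\le\frac{C}{\log\log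 N}.$$ -/

import Mathlib

namespace EulerTrunc

/-- The local factor `∏_{j=1}^m (1 - c_j(p) p^{-s})⁻¹` at `p`. -/
noncomputable def localFactor {m : ℕ} (c : Fin m → ℕ → ℂ) (p : ℕ) (s : ℂ) : ℂ :=
  ∏ j : Fin m, (1 - c j p * (p : ℂ) ^ (-s))⁻¹

/-- On `Re s > 1`, the function `L` is the `m`-fold Euler product over all primes with
coefficients `c_j(p)`, all of absolute value at most one. -/
def IsEulerProduct {m : ℕ} (c : Fin m → ℕ → ℂ) (L : ℂ → ℂ) : Prop :=
  (∀ (j : Fin m) (p : ℕ), p.Prime → ‖c j p‖ ≤ 1) ∧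
  ∀ s : ℂ, 1 < s.re → HasProd (fun p : Nat.Primes => localFactor c (p : ℕ) s) (L s)

/-- The Euler product truncated at the primes `p ≤ x`. -/
noncomputable def truncatedProduct {m : ℕ} (c : Fin m → ℕ → ℂ) (x : ℝ) (s : ℂ) : ℂ :=
  ∏ p ∈ (Finset.Iic ⌊x⌋₊).filter Nat.Prime, localFactor c p s

/-- The half plane `σ ≥ 1` together with the rectangle
`1 - δ/7 ≤ σ < 1`, `|t| ≤ 2 (log N)^3`. -/
def zeroFreeDomain (δ N : ℝ) : Set ℂ :=
  {s | 1 ≤ s.re} ∪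
    {s | 1 - δ / 7 ≤ s.re ∧ s.re < 1 ∧ |s.im| ≤ 2 * (Real.log N) ^ 3}

end EulerTrunc

/-!
Write `ℓ = log N`, `y = ℓ ^ A` and `w = s - 1`. In the half plane `Re s > 1` the Euler product is
the exponential of `∑ b(p) p ^ (-s) + H(s)`, where `b(p) = ∑ j, c_j(p)` and `H` collects the prime
powers `p ^ k` with `k ≥ 2` (`IsEulerProduct.eq_exp`). The series `H` converges absolutely for
`Re s > 1 / 2` and is bounded for `Re s ≥ 1 - δ / 7`, so `L(s) exp (-H(s))` is holomorphic and
nonvanishing in the zero-free region, which is convex after restriction to `|t| < 2 ℓ ^ 3`. There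
it has a holomorphic logarithm `F(w)` continuing `∑ b(p) p ^ (-1 - w)` (`exists_log_extension`,
`exists_log_continuation`). The growth hypothesis bounds `Re F` by `O(ℓ)`, and the
Borel–Carathéodory theorem on balls of radius `1 + δ / 7` about the points `s = 2 + i t` turns this
into `F(w) = O(ℓ)` for `-δ / 8 ≤ Re w ≤ 0` and `|Im w| ≤ ℓ` (`norm_log_continuation_le`).

It remains to compare `F(0)` with the sum of `b(p) / p` over `p ≤ y`. Instead of Perron's formula,
Newman's contour argument is used (`norm_sub_dirichletPoly_le`): with the kernel
`X ^ w (1 / w + w / R²)` and `X = ⌊y⌋`, both the tail of the series on the right half of the square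
`[-R, R]²` and the partial sum on its left half contribute only `O(1 / R + 1 / X)`, using nothing
about `b` beyond its boundedness. The contribution of `F` itself, integrated over the boundary of
the thin rectangle `-δ / 8 ≤ Re w ≤ 0`, is `O(ℓ / R² + ℓ R X ^ (-δ / 8))`, because the kernel
vanishes at `± i R`. Since `A δ / 8 ≥ 7 / 4`, the choice `R = ℓ ^ (3 / 5)` makes everything
`O(ℓ ^ (-3 / 20))` (`error_terms_le`), which is `O(1 / log ℓ)`.
-/

namespace EulerTrunc

open Complex Set Filter Topology MeasureTheory

/-! ### The residue theorem on rectangles -/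

/-- The integral of `φ` over the boundary, oriented counterclockwise, of the rectangle
`[-a, R] × [-R, R]`. -/
noncomputable def rectIntegral (a R : ℝ) (φ : ℂ → ℂ) : ℂ :=
  (∫ x : ℝ in (-a)..R, φ (x + (-R : ℝ) * I)) - (∫ x : ℝ in (-a)..R, φ (x + R * I)) +
    I * (∫ y : ℝ in (-R)..R, φ (R + y * I)) - I * (∫ y : ℝ in (-R)..R, φ ((-a : ℝ) + y * I))

/-- The closed rectangle `[-a, R] × [-R, R]`. -/
def rect (a R : ℝ) : Set ℂ := Icc (-a) R ×ℂ Icc (-R) R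

lemma mem_rect {a R : ℝ} {w : ℂ} :
    w ∈ rect a R ↔ (-a ≤ w.re ∧ w.re ≤ R) ∧ (-R ≤ w.im ∧ w.im ≤ R) := by
  simp [rect, mem_reProdIm]

/-- The boundary of the rectangle avoids the origin. -/
lemma rectIntegral_congr_boundary {a R : ℝ} {φ ψ : ℂ → ℂ} (ha : 0 < a) (hR : 0 < R)
    (h : ∀ w, w ≠ 0 → φ w = ψ w) : rectIntegral a R φ = rectIntegral a R ψ := by
  have h1 (x : ℝ) : φ (x + (-R : ℝ) * I) = ψ (x + (-R : ℝ) * I) :=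
    h _ fun h0 => by simpa [hR.ne'] using congrArg Complex.im h0
  have h2 (x : ℝ) : φ (x + R * I) = ψ (x + R * I) :=
    h _ fun h0 => by simpa [hR.ne'] using congrArg Complex.im h0
  have h3 (y : ℝ) : φ (R + y * I) = ψ (R + y * I) :=
    h _ fun h0 => by simpa [hR.ne'] using congrArg Complex.re h0
  have h4 (y : ℝ) : φ ((-a : ℝ) + y * I) = ψ ((-a : ℝ) + y * I) :=
    h _ fun h0 => by simpa [ha.ne'] using congrArg Complex.re h0
  simp only [rectIntegral, h1, h2, h3, h4]

lemma integral_horizontal_inv (p q : ℝ) {t : ℝ} (ht : t ≠ 0) :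
    ∫ x : ℝ in p..q, ((x : ℂ) + t * I)⁻¹ = log (q + t * I) - log (p + t * I) := by
  have hne (x : ℝ) : (x : ℂ) + t * I ≠ 0 := fun h => ht (by simpa using congrArg Complex.im h)
  refine intervalIntegral.integral_eq_sub_of_hasDerivAt
    (f := fun x : ℝ => log ((x : ℂ) + t * I)) (fun x _ => ?_)
    (Continuous.intervalIntegrable (Continuous.inv₀ (by fun_prop) hne) _ _)
  have h1 : HasDerivAt (fun x : ℝ => (x : ℂ) + t * I) 1 x :=
    (Complex.ofRealCLM.hasDerivAt (x := x)).add_const _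
  simpa using h1.clog_real (Or.inr (by simpa using ht))

lemma integral_vertical_inv (p q : ℝ) {u : ℝ} (hu : 0 < u) :
    I * ∫ y : ℝ in p..q, ((u : ℂ) + y * I)⁻¹ = log (u + q * I) - log (u + p * I) := by
  have hne (y : ℝ) : (u : ℂ) + y * I ≠ 0 := fun h => hu.ne' (by simpa using congrArg Complex.re h)
  rw [← intervalIntegral.integral_const_mul]
  refine intervalIntegral.integral_eq_sub_of_hasDerivAt
    (f := fun y : ℝ => log ((u : ℂ) + y * I)) (fun y _ => ?_)
    (Continuous.intervalIntegrable (continuous_const.mul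
      (Continuous.inv₀ (by fun_prop) hne)) _ _)
  have h1 : HasDerivAt (fun y : ℝ => (u : ℂ) + y * I) I y := by
    simpa using ((Complex.ofRealCLM.hasDerivAt (x := y)).mul_const I).const_add (u : ℂ)
  simpa [div_eq_mul_inv] using h1.clog_real (Or.inl (by simpa using hu))

lemma log_neg_of_im_neg {z : ℂ} (hz : z.im < 0) : log (-z) = log z + Real.pi * I := by
  simp [log, arg_neg_eq_arg_add_pi_of_im_neg hz]; ring

lemma rectIntegral_inv {a R : ℝ} (ha : 0 < a) (hR : 0 < R) :
    rectIntegral a R (fun w => w⁻¹) = 2 * Real.pi * I := by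
  have h4 : I * ∫ y : ℝ in (-R)..R, (((-a : ℝ) : ℂ) + y * I)⁻¹ =
      log (a + (-R : ℝ) * I) - log (a + R * I) := by
    have : (∫ y : ℝ in (-R)..R, (((-a : ℝ) : ℂ) + y * I)⁻¹) =
        ∫ y : ℝ in (-R)..R, -((a : ℂ) + y * I)⁻¹ := by
      have := intervalIntegral.integral_comp_neg (a := -R) (b := R)
        (fun y : ℝ => (((-a : ℝ) : ℂ) + y * I)⁻¹)
      rw [neg_neg] at this
      rw [← this]
      congr 1; ext y
      rw [← inv_neg]; congr 1; push_cast; ring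
    rw [this, intervalIntegral.integral_neg, mul_neg, integral_vertical_inv _ _ ha]
    ring
  rw [rectIntegral, h4, integral_horizontal_inv _ _ hR.ne', integral_horizontal_inv _ _
    (neg_ne_zero.2 hR.ne'), integral_vertical_inv _ _ hR]
  -- The residue comes from the jump of the principal branch across the negative axis.
  have e1 : log (((-a : ℝ) : ℂ) + R * I) = log (a + (-R : ℝ) * I) + Real.pi * I := by
    rw [← log_neg_of_im_neg (by simpa using hR)]; congr 1; push_cast; ring
  have e2 : log ((a : ℂ) + R * I) = log ((-a : ℝ) + (-R : ℝ) * I) + Real.pi * I := by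
    rw [← log_neg_of_im_neg (by simpa using hR)]; congr 1; push_cast; ring
  rw [e1, e2]; ring

/-- Cauchy's integral formula at the origin for a rectangle. -/
lemma rectIntegral_div {a R : ℝ} (ha : 0 < a) (hR : 0 < R) {G : ℂ → ℂ}
    (hG : DifferentiableOn ℂ G (rect a R)) :
    rectIntegral a R (fun w => G w * w⁻¹) = 2 * Real.pi * I * G 0 := by
  have hnhds : rect a R ∈ 𝓝 (0 : ℂ) := by
    refine mem_of_superset (((isOpen_Ioo (a := -a) (b := R)).reProdIm
      (isOpen_Ioo (a := -R) (b := R))).mem_nhds ?_) ?_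
    · simp [mem_reProdIm, ha, hR]
    · intro w hw
      rw [mem_reProdIm] at hw
      exact mem_rect.2 ⟨⟨hw.1.1.le, hw.1.2.le⟩, hw.2.1.le, hw.2.2.le⟩
  have hz : rectIntegral a R (dslope G 0) = 0 := by
    have := integral_boundary_rect_eq_zero_of_differentiable_on_off_countable (dslope G 0)
      ⟨-a, -R⟩ ⟨R, R⟩ {0} (countable_singleton 0) ?_ ?_
    · simpa [rectIntegral] using this
    · simp only [uIcc_of_le (show -a ≤ R by linarith), uIcc_of_le (show -R ≤ R by linarith)]
      exact (continuousOn_dslope hnhds).2 ⟨hG.continuousOn, hG.differentiableAt hnhds⟩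
    · rintro x ⟨hx, hx0⟩
      simp only [min_eq_left (show -a ≤ R by linarith), max_eq_right (show -a ≤ R by linarith),
        min_eq_left (show -R ≤ R by linarith), max_eq_right (show -R ≤ R by linarith)] at hx
      rw [differentiableAt_dslope_of_ne (by simpa using hx0)]
      refine hG.differentiableAt (mem_of_superset ((isOpen_Ioo.reProdIm isOpen_Ioo).mem_nhds hx) ?_)
      intro w hw
      rw [mem_reProdIm] at hw
      exact mem_rect.2 ⟨⟨hw.1.1.le, hw.1.2.le⟩, hw.2.1.le, hw.2.2.le⟩
  -- Only `1 / w` contributes, since `G w / w = dslope G 0 w + G 0 / w` away from the origin.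
  have hcont : ContinuousOn (dslope G 0) (rect a R) :=
    (continuousOn_dslope hnhds).2 ⟨hG.continuousOn, hG.differentiableAt hnhds⟩
  have hsum : rectIntegral a R (fun w => dslope G 0 w + G 0 * w⁻¹) =
      rectIntegral a R (dslope G 0) + G 0 * rectIntegral a R (fun w => w⁻¹) := by
    have key (p q : ℝ) (hpq : p ≤ q) (γ : ℝ → ℂ) (hγ : Continuous γ)
        (hmem : ∀ x ∈ Icc p q, γ x ∈ rect a R) (hne : ∀ x, γ x ≠ 0) :
        ∫ x in p..q, (dslope G 0 (γ x) + G 0 * (γ x)⁻¹) =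
          (∫ x in p..q, dslope G 0 (γ x)) + G 0 * ∫ x in p..q, (γ x)⁻¹ := by
      rw [intervalIntegral.integral_add, intervalIntegral.integral_const_mul]
      · refine ContinuousOn.intervalIntegrable ?_
        rw [uIcc_of_le hpq]
        exact hcont.comp hγ.continuousOn hmem
      · exact (continuous_const.mul (hγ.inv₀ hne)).intervalIntegrable _ _
    unfold rectIntegral
    rw [key _ _ (by linarith) (fun x : ℝ => (x : ℂ) + (-R : ℝ) * I) (by fun_prop),
      key _ _ (by linarith) (fun x : ℝ => (x : ℂ) + R * I) (by fun_prop),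
      key _ _ (by linarith) (fun x : ℝ => (R : ℂ) + x * I) (by fun_prop),
      key _ _ (by linarith) (fun x : ℝ => ((-a : ℝ) : ℂ) + x * I) (by fun_prop)]
    · ring
    · intro x hx; rw [mem_rect]; simp at hx ⊢; exact ⟨by linarith, hx⟩
    · intro x h; simpa [ha.ne'] using congrArg Complex.re h
    · intro x hx; rw [mem_rect]; simp at hx ⊢; exact ⟨by linarith, hx⟩
    · intro x h; simpa [hR.ne'] using congrArg Complex.re h
    · intro x hx; rw [mem_rect]; simp at hx ⊢; exact ⟨hx, by linarith⟩
    · intro x h; simpa [hR.ne'] using congrArg Complex.im h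
    · intro x hx; rw [mem_rect]; simp at hx ⊢; exact ⟨hx, by linarith⟩
    · intro x h; simpa [hR.ne'] using congrArg Complex.im h
  rw [rectIntegral_congr_boundary ha hR (ψ := fun w => dslope G 0 w + G 0 * w⁻¹), hsum, hz,
    rectIntegral_inv ha hR]
  · ring
  · intro w hw
    rw [dslope_of_ne _ hw, slope_def_field]
    field_simp
    ring

/-! ### Tails and partial sums of Dirichlet series -/

/-- The term `n + 1` of `∑ n ^ (-1 - σ)` is dominated by a telescoping difference. -/
lemma mul_rpow_neg_one_sub_le {σ : ℝ} (hσ : 0 < σ) {n : ℕ} (hn : 1 ≤ n) :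
    σ * ((n + 1 : ℕ) : ℝ) ^ (-1 - σ) ≤ (n : ℝ) ^ (-σ) - ((n + 1 : ℕ) : ℝ) ^ (-σ) := by
  have hn0 : (0 : ℝ) < n := by exact_mod_cast hn
  have hn1 : (0 : ℝ) < ((n + 1 : ℕ) : ℝ) := by positivity
  have hx : (n : ℝ) = ((n + 1 : ℕ) : ℝ) * (1 - 1 / ((n + 1 : ℕ) : ℝ)) := by
    field_simp; push_cast; ring
  have hpos : 0 < 1 - 1 / ((n + 1 : ℕ) : ℝ) := by
    by_contra h; rw [hx] at hn0; nlinarith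
  have hb : 1 + σ / ((n + 1 : ℕ) : ℝ) ≤ (1 - 1 / ((n + 1 : ℕ) : ℝ)) ^ (-σ) := by
    rw [Real.rpow_def_of_pos hpos]
    have h1 := Real.log_le_sub_one_of_pos hpos
    have h2 := Real.add_one_le_exp (Real.log (1 - 1 / ((n + 1 : ℕ) : ℝ)) * -σ)
    have h3 : σ / ((n + 1 : ℕ) : ℝ) = σ * (1 / ((n + 1 : ℕ) : ℝ)) := by ring
    rw [h3]
    nlinarith
  have h4 : (n : ℝ) ^ (-σ) = ((n + 1 : ℕ) : ℝ) ^ (-σ) * (1 - 1 / ((n + 1 : ℕ) : ℝ)) ^ (-σ) := by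
    rw [← Real.mul_rpow hn1.le hpos.le, ← hx]
  have h5 : ((n + 1 : ℕ) : ℝ) ^ (-1 - σ) = ((n + 1 : ℕ) : ℝ) ^ (-σ) / ((n + 1 : ℕ) : ℝ) := by
    rw [show -1 - σ = -σ - 1 by ring, Real.rpow_sub_one hn1.ne']
  rw [h4, h5]
  have h6 : 0 < ((n + 1 : ℕ) : ℝ) ^ (-σ) := by positivity
  calc _ = ((n + 1 : ℕ) : ℝ) ^ (-σ) * (1 + σ / ((n + 1 : ℕ) : ℝ)) - ((n + 1 : ℕ) : ℝ) ^ (-σ) := by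
        ring
    _ ≤ _ := by gcongr

lemma summable_rpow_neg_one_sub {σ : ℝ} (hσ : 0 < σ) :
    Summable fun n : ℕ => (n : ℝ) ^ (-1 - σ) :=
  Real.summable_nat_rpow.2 (by linarith)

/-- The tail of `∑ n ^ (-1 - σ)` beyond `X` is at most `X ^ (-σ) / σ`. -/
lemma mul_tsum_tail_le {σ : ℝ} (hσ : 0 < σ) {X : ℕ} (hX : 1 ≤ X) :
    σ * ∑' n : ℕ, ((n + (X + 1) : ℕ) : ℝ) ^ (-1 - σ) ≤ (X : ℝ) ^ (-σ) := by
  rw [← tsum_mul_left]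
  refine Real.tsum_le_of_sum_range_le (fun n => by positivity) fun k => ?_
  have : ∑ i ∈ Finset.range k, σ * ((i + (X + 1) : ℕ) : ℝ) ^ (-1 - σ) ≤
      ∑ i ∈ Finset.range k, (((i + X : ℕ) : ℝ) ^ (-σ) - ((i + 1 + X : ℕ) : ℝ) ^ (-σ)) := by
    refine Finset.sum_le_sum fun i _ => ?_
    have := mul_rpow_neg_one_sub_le hσ (n := i + X) (by omega)
    rwa [show i + X + 1 = i + (X + 1) by ring, show i + (X + 1) = i + 1 + X by ring] at *
  refine this.trans ?_
  rw [Finset.sum_range_sub' (fun i : ℕ => ((i + X : ℕ) : ℝ) ^ (-σ))]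
  have : 0 ≤ ((k + X : ℕ) : ℝ) ^ (-σ) := by positivity
  simp only [zero_add]; linarith

/-- The partial sum `∑ n ^ (u - 1)` over `n ≤ X` is at most `X ^ u (1 / u + 1 / X)`. -/
lemma mul_sum_rpow_sub_one_le {u : ℝ} (hu : 0 ≤ u) {X : ℕ} (hX : 1 ≤ X) :
    u * ∑ n ∈ Finset.range X, ((n + 1 : ℕ) : ℝ) ^ (u - 1) ≤ (X : ℝ) ^ u * (1 + u / X) := by
  have hX0 : (0 : ℝ) < X := by exact_mod_cast hX
  rcases hu.eq_or_lt with rfl | hu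
  · simp
  -- Each term is compared with a telescoping difference by Bernoulli's inequality. For `u ≤ 1` the
  -- terms decrease, for `u ≥ 1` they increase and the last one has to be kept apart.
  rcases le_total u 1 with h1 | h1
  · have key (n : ℕ) : u * ((n + 1 : ℕ) : ℝ) ^ (u - 1) ≤ ((n + 1 : ℕ) : ℝ) ^ u - (n : ℝ) ^ u := by
      have hn1 : (0 : ℝ) < ((n + 1 : ℕ) : ℝ) := by positivity
      have hx : (n : ℝ) = ((n + 1 : ℕ) : ℝ) * (1 + -(1 / ((n + 1 : ℕ) : ℝ))) := by
        field_simp; push_cast; ring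
      have hle : 1 / ((n + 1 : ℕ) : ℝ) ≤ 1 := by
        rw [div_le_one hn1]; exact_mod_cast Nat.le_add_left 1 n
      have hb := rpow_one_add_le_one_add_mul_self (s := -(1 / ((n + 1 : ℕ) : ℝ)))
        (by linarith) hu.le h1
      have h4 : (n : ℝ) ^ u = ((n + 1 : ℕ) : ℝ) ^ u * (1 + -(1 / ((n + 1 : ℕ) : ℝ))) ^ u := by
        rw [← Real.mul_rpow hn1.le (by linarith), ← hx]
      rw [h4, Real.rpow_sub_one hn1.ne']
      have h6 : 0 < ((n + 1 : ℕ) : ℝ) ^ u := by positivity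
      have := mul_le_mul_of_nonneg_left hb h6.le
      have e : ((n + 1 : ℕ) : ℝ) ^ u * (1 + u * -(1 / ((n + 1 : ℕ) : ℝ))) =
        ((n + 1 : ℕ) : ℝ) ^ u - u * (((n + 1 : ℕ) : ℝ) ^ u / ((n + 1 : ℕ) : ℝ)) := by ring
      linarith
    rw [Finset.mul_sum]
    refine (Finset.sum_le_sum fun n _ => key n).trans ?_
    rw [Finset.sum_range_sub (fun n : ℕ => (n : ℝ) ^ u)]
    have h2 : 0 ≤ (X : ℝ) ^ u * (u / X) := by positivity
    rw [Nat.cast_zero, Real.zero_rpow hu.ne']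
    linarith
  · have key (n : ℕ) : u * ((n + 1 : ℕ) : ℝ) ^ (u - 1) ≤
        ((n + 1 + 1 : ℕ) : ℝ) ^ u - ((n + 1 : ℕ) : ℝ) ^ u := by
      have hn1 : (0 : ℝ) < ((n + 1 : ℕ) : ℝ) := by positivity
      have hx : ((n + 1 + 1 : ℕ) : ℝ) = ((n + 1 : ℕ) : ℝ) * (1 + 1 / ((n + 1 : ℕ) : ℝ)) := by
        field_simp; push_cast; ring
      have h0 : 0 ≤ 1 / ((n + 1 : ℕ) : ℝ) := by positivity
      have hb := one_add_mul_self_le_rpow_one_add (s := 1 / ((n + 1 : ℕ) : ℝ)) (by linarith) h1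
      rw [hx, Real.mul_rpow hn1.le (by linarith), Real.rpow_sub_one hn1.ne']
      have h6 : 0 < ((n + 1 : ℕ) : ℝ) ^ u := by positivity
      have := mul_le_mul_of_nonneg_left hb h6.le
      have e : ((n + 1 : ℕ) : ℝ) ^ u * (1 + u * (1 / ((n + 1 : ℕ) : ℝ))) =
        ((n + 1 : ℕ) : ℝ) ^ u + u * (((n + 1 : ℕ) : ℝ) ^ u / ((n + 1 : ℕ) : ℝ)) := by ring
      linarith
    obtain ⟨Y, rfl⟩ : ∃ Y, X = Y + 1 := ⟨X - 1, by omega⟩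
    rw [Finset.sum_range_succ, mul_add, Finset.mul_sum]
    have h2 := Finset.sum_le_sum fun n (_ : n ∈ Finset.range Y) => key n
    rw [Finset.sum_range_sub (fun n : ℕ => ((n + 1 : ℕ) : ℝ) ^ u)] at h2
    rw [Real.rpow_sub_one hX0.ne']
    have e : ((Y + 1 : ℕ) : ℝ) ^ u * (1 + u / ((Y + 1 : ℕ) : ℝ)) = ((Y + 1 : ℕ) : ℝ) ^ u +
      u * (((Y + 1 : ℕ) : ℝ) ^ u / ((Y + 1 : ℕ) : ℝ)) := by ring
    have h3 : (0 : ℝ) ≤ ((0 + 1 : ℕ) : ℝ) ^ u := by positivity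
    linarith

/-- The Dirichlet polynomial `∑ b(n) n ^ (-s)` over `n ≤ X`. -/
noncomputable def dirichletPoly (b : ℕ → ℂ) (X : ℕ) (s : ℂ) : ℂ :=
  ∑ n ∈ Finset.range X, b (n + 1) * ((n + 1 : ℕ) : ℂ) ^ (-s)

lemma norm_natCast_succ_cpow (n : ℕ) (s : ℂ) :
    ‖((n + 1 : ℕ) : ℂ) ^ s‖ = ((n + 1 : ℕ) : ℝ) ^ s.re :=
  norm_natCast_cpow_of_pos n.succ_pos s

lemma differentiable_dirichletPoly (b : ℕ → ℂ) (X : ℕ) :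
    Differentiable ℂ (dirichletPoly b X) := by
  unfold dirichletPoly
  refine Differentiable.fun_sum fun n _ => Differentiable.const_mul ?_ _
  exact Differentiable.const_cpow differentiable_neg (Or.inl (Nat.cast_ne_zero.2 n.succ_ne_zero))

lemma norm_dirichletPoly_mul_le {b : ℕ → ℂ} {m : ℝ} (hm : 0 ≤ m) (hb : ∀ n, ‖b n‖ ≤ m) {X : ℕ}
    (hX : 1 ≤ X) {w : ℂ} (hw : w.re ≤ 0) :
    |w.re| * (‖dirichletPoly b X (1 + w)‖ * (X : ℝ) ^ w.re) ≤ m * (1 + |w.re| / X) := by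
  have hX0 : (0 : ℝ) < X := by exact_mod_cast hX
  have h1 : ‖dirichletPoly b X (1 + w)‖ ≤
      m * ∑ n ∈ Finset.range X, ((n + 1 : ℕ) : ℝ) ^ (|w.re| - 1) := by
    rw [Finset.mul_sum]
    refine (norm_sum_le _ _).trans (Finset.sum_le_sum fun n _ => ?_)
    rw [norm_mul, norm_natCast_succ_cpow, abs_of_nonpos hw]
    have : (-(1 + w)).re = -w.re - 1 := by simp; ring
    rw [this]
    gcongr
    exact hb _
  have h2 := mul_sum_rpow_sub_one_le (abs_nonneg w.re) hX
  have h3 : (X : ℝ) ^ |w.re| * (X : ℝ) ^ w.re = 1 := by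
    rw [← Real.rpow_add hX0, abs_of_nonpos hw]; simp
  calc _ ≤ |w.re| * ((m * ∑ n ∈ Finset.range X, ((n + 1 : ℕ) : ℝ) ^ (|w.re| - 1)) *
        (X : ℝ) ^ w.re) := by gcongr
    _ = m * (|w.re| * ∑ n ∈ Finset.range X, ((n + 1 : ℕ) : ℝ) ^ (|w.re| - 1)) *
        (X : ℝ) ^ w.re := by ring
    _ ≤ m * ((X : ℝ) ^ |w.re| * (1 + |w.re| / X)) * (X : ℝ) ^ w.re := by gcongr
    _ = m * (1 + |w.re| / X) * ((X : ℝ) ^ |w.re| * (X : ℝ) ^ w.re) := by ring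
    _ = _ := by rw [h3, mul_one]

lemma LSeries_eq_tsum_succ {b : ℕ → ℂ} {s : ℂ} (hs : LSeriesSummable b s) :
    LSeries b s = ∑' n : ℕ, b (n + 1) * ((n + 1 : ℕ) : ℂ) ^ (-s) := by
  rw [LSeries, hs.tsum_eq_zero_add, LSeries.term_zero, zero_add]
  congr 1; ext n
  rw [LSeries.term_of_ne_zero n.succ_ne_zero, cpow_neg, div_eq_mul_inv]

lemma lseriesSummable_of_bounded {b : ℕ → ℂ} {m : ℝ} (hb : ∀ n, ‖b n‖ ≤ m) {w : ℂ}
    (hw : 0 < w.re) : LSeriesSummable b (1 + w) :=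
  LSeriesSummable_of_bounded_of_one_lt_re (fun n _ => hb n) (by simpa using hw)

lemma norm_LSeries_sub_dirichletPoly_mul_le {b : ℕ → ℂ} {m : ℝ} (hm : 0 ≤ m)
    (hb : ∀ n, ‖b n‖ ≤ m) {X : ℕ} (hX : 1 ≤ X) {w : ℂ} (hw : 0 < w.re) :
    w.re * (‖LSeries b (1 + w) - dirichletPoly b X (1 + w)‖ * (X : ℝ) ^ w.re) ≤ m := by
  have hX0 : (0 : ℝ) < X := by exact_mod_cast hX
  have hs := lseriesSummable_of_bounded hb hw
  have hsum : Summable fun n : ℕ => b (n + 1) * ((n + 1 : ℕ) : ℂ) ^ (-(1 + w)) := by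
    refine ((summable_nat_add_iff 1).2 hs).congr fun n => ?_
    rw [LSeries.term_of_ne_zero n.succ_ne_zero, cpow_neg, div_eq_mul_inv]
  have h0 : LSeries b (1 + w) - dirichletPoly b X (1 + w) =
      ∑' n : ℕ, b (n + X + 1) * ((n + X + 1 : ℕ) : ℂ) ^ (-(1 + w)) := by
    rw [LSeries_eq_tsum_succ hs, ← hsum.sum_add_tsum_nat_add X, dirichletPoly, add_sub_cancel_left]
  have hσ := summable_rpow_neg_one_sub hw
  have h1 : ‖LSeries b (1 + w) - dirichletPoly b X (1 + w)‖ ≤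
      m * ∑' n : ℕ, ((n + (X + 1) : ℕ) : ℝ) ^ (-1 - w.re) := by
    rw [h0, ← tsum_mul_left]
    refine tsum_of_norm_bounded
      (((summable_nat_add_iff (X + 1)).2 hσ).mul_left m).hasSum fun n => ?_
    rw [norm_mul, norm_natCast_succ_cpow]
    have : (-(1 + w)).re = -1 - w.re := by simp; ring
    rw [this]
    exact mul_le_mul_of_nonneg_right (hb _) (by positivity)
  have h2 := mul_tsum_tail_le hw hX
  have h3 : (X : ℝ) ^ (-w.re) * (X : ℝ) ^ w.re = 1 := by rw [← Real.rpow_add hX0]; simp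
  calc _ ≤ w.re * ((m * ∑' n : ℕ, ((n + (X + 1) : ℕ) : ℝ) ^ (-1 - w.re)) * (X : ℝ) ^ w.re) := by
        gcongr
    _ = m * (w.re * ∑' n : ℕ, ((n + (X + 1) : ℕ) : ℝ) ^ (-1 - w.re)) * (X : ℝ) ^ w.re := by ring
    _ ≤ m * (X : ℝ) ^ (-w.re) * (X : ℝ) ^ w.re := by gcongr
    _ = _ := by rw [mul_assoc, h3, mul_one]

/-! ### Newman's contour argument -/

/-- Newman's kernel `1 / w + w / R²`. It has residue one at the origin and vanishes at `± i R`. -/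
noncomputable def newmanKernel (R : ℝ) (w : ℂ) : ℂ := w⁻¹ + w / (R : ℂ) ^ 2

lemma norm_newmanKernel_le_of_im {R : ℝ} (hR : 0 < R) {w : ℂ} (hw : |w.im| = R) :
    ‖newmanKernel R w‖ ≤ 2 * |w.re| / R ^ 2 := by
  have hw0 : w ≠ 0 := by rintro rfl; simp at hw; exact hR.ne hw
  have hRc : (R : ℂ) ≠ 0 := by exact_mod_cast hR.ne'
  have hsq : (R : ℂ) ^ 2 = (w.im : ℂ) ^ 2 := by rw [← hw]; norm_cast; exact sq_abs _
  have h1 : newmanKernel R w = w.re * (w.re + 2 * w.im * I) / (w * (R : ℂ) ^ 2) := by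
    have h2 : w ^ 2 + (R : ℂ) ^ 2 = w.re * (w.re + 2 * w.im * I) := by
      rw [hsq]
      nth_rewrite 1 [← re_add_im w]
      ring_nf
      rw [I_sq]; ring
    rw [← h2, newmanKernel]
    field_simp; ring
  have h3 : ‖(w.re + 2 * w.im * I : ℂ)‖ ≤ 2 * ‖w‖ := by
    have : (w.re + 2 * w.im * I : ℂ) = 2 * w - w.re := by
      nth_rewrite 3 [← re_add_im w]; ring
    rw [← sq_le_sq₀ (norm_nonneg _) (by positivity), mul_pow, Complex.sq_norm, Complex.sq_norm,
      normSq_apply, normSq_apply]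
    simp
    nlinarith [sq_nonneg w.re]
  have hwn : 0 < ‖w‖ := norm_pos_iff.2 hw0
  rw [h1, norm_div, norm_mul, norm_mul, norm_pow, norm_real, norm_real, Real.norm_eq_abs,
    Real.norm_eq_abs, abs_of_pos hR, div_le_div_iff₀ (by positivity) (by positivity)]
  have := abs_nonneg w.re
  calc |w.re| * ‖(w.re + 2 * w.im * I : ℂ)‖ * R ^ 2 ≤ |w.re| * (2 * ‖w‖) * R ^ 2 := by gcongr
    _ = _ := by ring

lemma norm_newmanKernel_le_of_re {R a : ℝ} (hR : 0 < R) (ha : 0 < a) (haR : a ≤ R) {w : ℂ}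
    (hre : |w.re| = a) (him : |w.im| ≤ R) : ‖newmanKernel R w‖ ≤ 1 / a + 2 / R := by
  have h1 : a ≤ ‖w‖ := hre ▸ abs_re_le_norm w
  have h2 : ‖w‖ ≤ 2 * R := (norm_le_abs_re_add_abs_im w).trans (by linarith)
  refine (norm_add_le _ _).trans (add_le_add ?_ ?_)
  · rw [norm_inv, one_div]; exact inv_anti₀ ha h1
  · rw [norm_div, norm_pow, norm_real, Real.norm_eq_abs, abs_of_pos hR,
      div_le_div_iff₀ (by positivity) hR]
    nlinarith

/-- The residue theorem for Newman's kernel. -/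
lemma rectIntegral_newman {a R : ℝ} (ha : 0 < a) (hR : 0 < R) {X : ℕ} (hX : 1 ≤ X) {F : ℂ → ℂ}
    (hF : DifferentiableOn ℂ F (rect a R)) :
    rectIntegral a R (fun w => F w * (X : ℂ) ^ w * newmanKernel R w) = 2 * Real.pi * I * F 0 := by
  have hX0 : (X : ℂ) ≠ 0 := Nat.cast_ne_zero.2 (by omega)
  have hRc : (R : ℂ) ≠ 0 := by exact_mod_cast hR.ne'
  have hpow : Differentiable ℂ fun w : ℂ => (X : ℂ) ^ w :=
    differentiable_id.const_cpow (Or.inl hX0)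
  have := rectIntegral_div ha hR (G := fun w => F w * (X : ℂ) ^ w * (1 + w ^ 2 / (R : ℂ) ^ 2))
    ((hF.mul hpow.differentiableOn).mul (by fun_prop))
  simp only [cpow_zero, mul_one, ne_eq, OfNat.ofNat_ne_zero, not_false_eq_true, zero_pow,
    zero_div, add_zero] at this
  rw [← this]
  refine rectIntegral_congr_boundary ha hR fun w hw => ?_
  rw [newmanKernel]; field_simp

/-- Newman's contour argument. A holomorphic `F` that agrees with `∑ b(n) n ^ (-1 - w)` to the
right of the imaginary axis, with bounded `b`, has at the origin a value close to the partial
sum `∑ b(n) / n` over `n ≤ X`: the tail is integrated over the right half of the square of side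
`2 R`, the partial sum (an entire function) over its left half, and `F` itself only over the thin
rectangle `[-κ, 0] × [-R, R]`, where it is bounded by `B`. -/
theorem norm_sub_dirichletPoly_le {b : ℕ → ℂ} {m κ R B : ℝ} {X : ℕ} {F : ℂ → ℂ} (hm : 0 ≤ m)
    (hb : ∀ n, ‖b n‖ ≤ m) (hκ : 0 < κ) (hκR : κ ≤ R) (hB : 0 ≤ B) (hX : 1 ≤ X)
    (hF : DifferentiableOn ℂ F (rect κ R))
    (hFb : ∀ w ∈ rect κ R, 0 < w.re → F w = LSeries b (1 + w))
    (hFB : ∀ w ∈ rect κ R, w.re ≤ 0 → ‖F w‖ ≤ B) :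
    ‖F 0 - dirichletPoly b X 1‖ ≤
      20 * m / R + 10 * m / X + 4 * B * κ ^ 2 / R ^ 2 + B * (X : ℝ) ^ (-κ) * (2 * R / κ + 4) := by
  have hR : 0 < R := hκ.trans_le hκR
  have hX0 : (0 : ℝ) < X := by exact_mod_cast hX
  have hX1 : (1 : ℝ) ≤ X := by exact_mod_cast hX
  have hXc : (X : ℂ) ≠ 0 := Nat.cast_ne_zero.2 (by omega)
  have hpow : Differentiable ℂ fun w : ℂ => (X : ℂ) ^ w :=
    differentiable_id.const_cpow (Or.inl hXc)
  have hnorm (w : ℂ) : ‖(X : ℂ) ^ w‖ = (X : ℝ) ^ w.re := norm_natCast_cpow_of_pos (by omega) w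
  set f : ℂ → ℂ := fun w => dirichletPoly b X (1 + w) with hf
  have hfd : Differentiable ℂ f := (differentiable_dirichletPoly b X).comp (by fun_prop)
  set φ : ℂ → ℂ := fun w => F w * (X : ℂ) ^ w * newmanKernel R w with hφ
  set ψ : ℂ → ℂ := fun w => f w * (X : ℂ) ^ w * newmanKernel R w with hψ
  have e1 : rectIntegral κ R φ = 2 * Real.pi * I * F 0 := rectIntegral_newman hκ hR hX hF
  have e2 : rectIntegral R R ψ = 2 * Real.pi * I * f 0 :=
    rectIntegral_newman hR hR hX hfd.differentiableOn
  have hφc : ContinuousOn φ (rect κ R \ {0}) := by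
    refine ((hF.continuousOn.mono sdiff_subset).mul hpow.continuous.continuousOn).mul ?_
    exact (continuousOn_inv₀.mono fun w hw => hw.2).add (by fun_prop)
  have hψc : ContinuousOn ψ {0}ᶜ := by
    refine (hfd.continuous.continuousOn.mul hpow.continuous.continuousOn).mul ?_
    exact (continuousOn_inv₀.mono fun w hw => hw).add (by fun_prop)
  -- The two horizontal sides are treated simultaneously, at height `t = ± R`.
  have hφi (t : ℝ) (ht : |t| = R) (p q : ℝ) (hp : -κ ≤ p) (hpq : p ≤ q) (hq : q ≤ R) :
      IntervalIntegrable (fun x : ℝ => φ (x + t * I)) volume p q := by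
    refine ContinuousOn.intervalIntegrable (hφc.comp (by fun_prop) fun x hx => ?_)
    rw [uIcc_of_le hpq] at hx
    refine ⟨mem_rect.2 ?_, fun h => ?_⟩
    · have := abs_le.1 ht.le
      simp; exact ⟨⟨by linarith [hx.1], by linarith [hx.2]⟩, this⟩
    · have : t = 0 := by simpa using congrArg Complex.im h
      rw [this] at ht; simp at ht; exact hR.ne ht
  have hψi (t : ℝ) (ht : |t| = R) (p q : ℝ) :
      IntervalIntegrable (fun x : ℝ => ψ (x + t * I)) volume p q := by
    refine ContinuousOn.intervalIntegrable (hψc.comp (by fun_prop) fun x hx => ?_)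
    intro h
    have : t = 0 := by simpa using congrArg Complex.im h
    rw [this] at ht; simp at ht; exact hR.ne ht
  have hsplit (t : ℝ) (ht : |t| = R) :
      (∫ x : ℝ in (-κ)..R, φ (x + t * I)) - (∫ x : ℝ in (-R)..R, ψ (x + t * I)) =
        (∫ x : ℝ in (0 : ℝ)..R, (φ (x + t * I) - ψ (x + t * I))) +
          (∫ x : ℝ in (-κ)..0, φ (x + t * I)) - (∫ x : ℝ in (-R)..0, ψ (x + t * I)) := by
    rw [intervalIntegral.integral_sub (hφi t ht _ _ (by linarith) hR.le le_rfl) (hψi t ht _ _),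
      ← intervalIntegral.integral_add_adjacent_intervals
        (hφi t ht (-κ) 0 le_rfl (by linarith) hR.le) (hφi t ht 0 R (by linarith) hR.le le_rfl),
      ← intervalIntegral.integral_add_adjacent_intervals (hψi t ht (-R) 0) (hψi t ht 0 R)]
    ring
  -- Pointwise bounds for the three integrands.
  have htail (w : ℂ) (hw : w ∈ rect κ R) (h0 : 0 < w.re) (k : ℝ)
      (hk : ‖newmanKernel R w‖ ≤ k * w.re) (hk0 : 0 ≤ k) : ‖φ w - ψ w‖ ≤ k * m := by
    have : φ w - ψ w = (LSeries b (1 + w) - f w) * (X : ℂ) ^ w * newmanKernel R w := by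
      simp only [hφ, hψ, hFb w hw h0]; ring
    rw [this, norm_mul, norm_mul, hnorm]
    have h1 := norm_LSeries_sub_dirichletPoly_mul_le hm hb hX h0
    calc _ ≤ ‖LSeries b (1 + w) - f w‖ * (X : ℝ) ^ w.re * (k * w.re) := by gcongr
      _ = k * (w.re * (‖LSeries b (1 + w) - f w‖ * (X : ℝ) ^ w.re)) := by ring
      _ ≤ _ := by gcongr
  have hpoly (w : ℂ) (h0 : w.re ≤ 0) (hwR : |w.re| ≤ R) (k : ℝ)
      (hk : ‖newmanKernel R w‖ ≤ k * |w.re|) (hk0 : 0 ≤ k) :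
      ‖ψ w‖ ≤ k * (m * (1 + R / X)) := by
    rw [hψ]; simp only; rw [norm_mul, norm_mul, hnorm]
    have h1 := norm_dirichletPoly_mul_le hm hb hX h0
    calc _ ≤ ‖f w‖ * (X : ℝ) ^ w.re * (k * |w.re|) := by gcongr
      _ = k * (|w.re| * (‖f w‖ * (X : ℝ) ^ w.re)) := by ring
      _ ≤ k * (m * (1 + |w.re| / X)) := by gcongr
      _ ≤ _ := by gcongr
  have hthin (w : ℂ) (hw : w ∈ rect κ R) (h0 : w.re ≤ 0) (k : ℝ) (hk : ‖newmanKernel R w‖ ≤ k) :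
      ‖φ w‖ ≤ B * (X : ℝ) ^ w.re * k := by
    rw [hφ]; simp only; rw [norm_mul, norm_mul, hnorm]
    gcongr
    exact hFB w hw h0
  -- The tail of the series on the sides `Re w ≥ 0`, horizontal and vertical.
  have hA (t : ℝ) (ht : |t| = R) :
      ‖∫ x : ℝ in (0 : ℝ)..R, (φ (x + t * I) - ψ (x + t * I))‖ ≤ 2 * m / R := by
    refine (intervalIntegral.norm_integral_le_of_norm_le_const (C := 2 / R ^ 2 * m)
      fun x hx => ?_).trans_eq ?_
    · rw [uIoc_of_le hR.le] at hx
      refine htail _ (mem_rect.2 ?_) (by simpa using hx.1) _ ?_ (by positivity)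
      · have := abs_le.1 ht.le
        simp; exact ⟨⟨by linarith [hx.1], hx.2⟩, this⟩
      · refine (norm_newmanKernel_le_of_im hR (by simpa using ht)).trans_eq ?_
        simp [abs_of_pos hx.1]; ring
    · rw [sub_zero, abs_of_pos hR]; field_simp
  have hA2 : ‖∫ y : ℝ in (-R)..R, (φ (R + y * I) - ψ (R + y * I))‖ ≤ 6 * m / R := by
    refine (intervalIntegral.norm_integral_le_of_norm_le_const (C := 3 / R ^ 2 * m)
      fun y hy => ?_).trans_eq ?_
    · rw [uIoc_of_le (by linarith)] at hy
      have hy' : |y| ≤ R := abs_le.2 ⟨hy.1.le, hy.2⟩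
      refine htail _ (mem_rect.2 ?_) (by simpa using hR) _ ?_ (by positivity)
      · simp; exact ⟨by linarith, hy.1.le, hy.2⟩
      · refine (norm_newmanKernel_le_of_re hR hR le_rfl (by simp [abs_of_pos hR])
          (by simpa using hy')).trans_eq ?_
        simp; field_simp; norm_num
    · rw [sub_neg_eq_add, abs_of_pos (by linarith)]; field_simp; ring
  -- The partial sum on the sides with `Re w ≤ 0` of the square.
  have hC (t : ℝ) (ht : |t| = R) :
      ‖∫ x : ℝ in (-R)..0, ψ (x + t * I)‖ ≤ 2 * m / R + 2 * m / X := by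
    refine (intervalIntegral.norm_integral_le_of_norm_le_const
      (C := 2 / R ^ 2 * (m * (1 + R / X))) fun x hx => ?_).trans_eq ?_
    · rw [uIoc_of_le (by linarith)] at hx
      refine hpoly _ (by simpa using hx.2) ?_ _ ?_ (by positivity)
      · simp; exact abs_le.2 ⟨hx.1.le, by linarith [hx.2]⟩
      · refine (norm_newmanKernel_le_of_im hR (by simpa using ht)).trans_eq ?_
        ring
    · rw [sub_neg_eq_add, zero_add, abs_of_pos hR]; field_simp
  have hC2 : ‖∫ y : ℝ in (-R)..R, ψ ((-R : ℝ) + y * I)‖ ≤ 6 * m / R + 6 * m / X := by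
    refine (intervalIntegral.norm_integral_le_of_norm_le_const
      (C := 3 / R ^ 2 * (m * (1 + R / X))) fun y hy => ?_).trans_eq ?_
    · rw [uIoc_of_le (by linarith)] at hy
      have hy' : |y| ≤ R := abs_le.2 ⟨hy.1.le, hy.2⟩
      refine hpoly _ (by simpa using hR.le) (by simp [abs_of_pos hR]) _ ?_ (by positivity)
      refine (norm_newmanKernel_le_of_re hR hR le_rfl (by simp [abs_of_pos hR])
          (by simpa using hy')).trans_eq ?_
      simp [abs_of_pos hR]; field_simp; norm_num
    · rw [sub_neg_eq_add, abs_of_pos (by linarith)]; field_simp; ring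
  -- The function `F` on the sides with `Re w ≤ 0` of the thin rectangle.
  have hD (t : ℝ) (ht : |t| = R) :
      ‖∫ x : ℝ in (-κ)..0, φ (x + t * I)‖ ≤ 2 * B * κ ^ 2 / R ^ 2 := by
    refine (intervalIntegral.norm_integral_le_of_norm_le_const
      (C := B * 1 * (2 * κ / R ^ 2)) fun x hx => ?_).trans_eq ?_
    · rw [uIoc_of_le (by linarith)] at hx
      have hmem : (x + t * I : ℂ) ∈ rect κ R := by
        have := abs_le.1 ht.le
        rw [mem_rect]; simp; exact ⟨⟨hx.1.le, by linarith [hx.2]⟩, this⟩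
      refine (hthin _ hmem (by simpa using hx.2) (2 * κ / R ^ 2) ?_).trans ?_
      · refine (norm_newmanKernel_le_of_im hR (by simpa using ht)).trans ?_
        gcongr
        simp; exact abs_le.2 ⟨hx.1.le, by linarith [hx.2]⟩
      · gcongr
        exact Real.rpow_le_one_of_one_le_of_nonpos hX1 (by simpa using hx.2)
    · rw [sub_neg_eq_add, zero_add, abs_of_pos hκ]; field_simp
  have hD2 : ‖∫ y : ℝ in (-R)..R, φ ((-κ : ℝ) + y * I)‖ ≤
      B * (X : ℝ) ^ (-κ) * (2 * R / κ + 4) := by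
    refine (intervalIntegral.norm_integral_le_of_norm_le_const
      (C := B * (X : ℝ) ^ (-κ) * (1 / κ + 2 / R)) fun y hy => ?_).trans_eq ?_
    · rw [uIoc_of_le (by linarith)] at hy
      have hy' : |y| ≤ R := abs_le.2 ⟨hy.1.le, hy.2⟩
      have hmem : (((-κ : ℝ) : ℂ) + y * I : ℂ) ∈ rect κ R := by
        rw [mem_rect]; simp; exact ⟨by linarith, hy.1.le, hy.2⟩
      refine (hthin _ hmem (by simpa using hκ.le) (1 / κ + 2 / R) ?_).trans_eq ?_
      · exact norm_newmanKernel_le_of_re hR hκ hκR (by simp [abs_of_pos hκ]) (by simpa using hy')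
      · simp
    · rw [sub_neg_eq_add, abs_of_pos (by linarith)]; field_simp; ring
  have hφv : IntervalIntegrable (fun y : ℝ => φ (R + y * I)) volume (-R) R := by
    refine ContinuousOn.intervalIntegrable (hφc.comp (by fun_prop) fun y hy => ?_)
    rw [uIcc_of_le (by linarith)] at hy
    refine ⟨mem_rect.2 ?_, fun h => hR.ne' (by simpa using congrArg Complex.re h)⟩
    simp; exact ⟨by linarith, hy⟩
  have hψv : IntervalIntegrable (fun y : ℝ => ψ (R + y * I)) volume (-R) R :=
    ContinuousOn.intervalIntegrable (hψc.comp (by fun_prop) fun y hy h =>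
      hR.ne' (by simpa using congrArg Complex.re h))
  have hneg : |(-R)| = R := by rw [abs_neg, abs_of_pos hR]
  have hpos : |R| = R := abs_of_pos hR
  have key : 2 * Real.pi * I * (F 0 - f 0) =
      ((∫ x : ℝ in (0 : ℝ)..R, (φ (x + (-R : ℝ) * I) - ψ (x + (-R : ℝ) * I))) +
          (∫ x : ℝ in (-κ)..0, φ (x + (-R : ℝ) * I)) - (∫ x : ℝ in (-R)..0, ψ (x + (-R : ℝ) * I))) -
      ((∫ x : ℝ in (0 : ℝ)..R, (φ (x + R * I) - ψ (x + R * I))) +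
          (∫ x : ℝ in (-κ)..0, φ (x + R * I)) - (∫ x : ℝ in (-R)..0, ψ (x + R * I))) +
      I * (∫ y : ℝ in (-R)..R, (φ (R + y * I) - ψ (R + y * I))) -
      I * (∫ y : ℝ in (-R)..R, φ ((-κ : ℝ) + y * I)) +
      I * (∫ y : ℝ in (-R)..R, ψ ((-R : ℝ) + y * I)) := by
    rw [mul_sub, ← e1, ← e2, ← hsplit _ hneg, ← hsplit _ hpos,
      intervalIntegral.integral_sub hφv hψv]
    unfold rectIntegral
    ring
  have hI (z : ℂ) : ‖I * z‖ = ‖z‖ := by simp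
  have hpi : ‖(2 * Real.pi * I : ℂ)‖ = 2 * Real.pi := by
    simp [abs_of_pos Real.pi_pos]
  have hle : ‖2 * Real.pi * I * (F 0 - f 0)‖ ≤
      ((2 * m / R + 2 * B * κ ^ 2 / R ^ 2 + (2 * m / R + 2 * m / X)) +
      (2 * m / R + 2 * B * κ ^ 2 / R ^ 2 + (2 * m / R + 2 * m / X))) + 6 * m / R +
      B * (X : ℝ) ^ (-κ) * (2 * R / κ + 4) + (6 * m / R + 6 * m / X) := by
    rw [key]
    refine norm_add_le_of_le (norm_sub_le_of_le (norm_add_le_of_le (norm_sub_le_of_le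
      (norm_sub_le_of_le (norm_add_le_of_le (hA _ hneg) (hD _ hneg)) (hC _ hneg))
      (norm_sub_le_of_le (norm_add_le_of_le (hA _ hpos) (hD _ hpos)) (hC _ hpos)))
      ((hI _).trans_le hA2)) ((hI _).trans_le hD2)) ((hI _).trans_le hC2)
  have hf0 : f 0 = dirichletPoly b X 1 := by simp [hf]
  rw [norm_mul, hpi, hf0] at hle
  have h2pi : (1 : ℝ) ≤ 2 * Real.pi := by linarith [Real.pi_gt_three]
  refine (le_mul_of_one_le_left (norm_nonneg _) h2pi).trans (hle.trans_eq ?_)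
  ring

/-! ### Holomorphic logarithms -/

lemma isSimplyConnected_of_convex {U : Set ℂ} (hU : Convex ℝ U) (hne : U.Nonempty) :
    IsSimplyConnected U := by
  have := hU.contractibleSpace hne
  exact SimplyConnectedSpace.ofContractible U

/-- A continuous branch of the logarithm of a holomorphic function is holomorphic. -/
lemma differentiableOn_of_exp_eq {U : Set ℂ} (hU : IsOpen U) {M F : ℂ → ℂ}
    (hM : DifferentiableOn ℂ M U) (hF : ContinuousOn F U) (hexp : ∀ s ∈ U, exp (F s) = M s) :
    DifferentiableOn ℂ F U := by
  intro s₀ hs₀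
  have hUn : U ∈ 𝓝 s₀ := hU.mem_nhds hs₀
  have hM0 : M s₀ ≠ 0 := hexp s₀ hs₀ ▸ exp_ne_zero _
  have hd : DifferentiableAt ℂ (fun s => F s₀ + log (M s / M s₀)) s₀ := by
    refine DifferentiableAt.const_add _ (DifferentiableAt.clog ?_ ?_)
    · exact (hM.differentiableAt hUn).div_const _
    · rw [div_self hM0]; exact one_mem_slitPlane
  refine (hd.congr_of_eventuallyEq ?_).differentiableWithinAt
  have hlim : ∀ᶠ s in 𝓝 s₀, ‖F s - F s₀‖ < Real.pi := by
    have h1 : Tendsto (fun s => ‖F s - F s₀‖) (𝓝 s₀) (𝓝 ‖F s₀ - F s₀‖) :=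
      ((hF.continuousAt hUn).sub continuousAt_const).norm
    rw [sub_self, norm_zero] at h1
    exact h1.eventually_lt_const Real.pi_pos
  filter_upwards [hlim, hUn] with s hs hsU
  have him := abs_lt.1 ((abs_im_le_norm (F s - F s₀)).trans_lt hs)
  rw [← hexp s hsU, ← hexp s₀ hs₀, ← exp_sub, log_exp him.1 him.2.le]
  ring

/-- A nonvanishing holomorphic function on a convex open set has there a holomorphic logarithm,
which can be made to extend a logarithm given on a connected open subset. -/
lemma exists_log_extension {U V : Set ℂ} (hU : IsOpen U) (hUc : Convex ℝ U) (hV : IsOpen V)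
    (hVc : IsPreconnected V) (hVne : V.Nonempty) (hVU : V ⊆ U) {M P : ℂ → ℂ}
    (hM : DifferentiableOn ℂ M U) (hM0 : ∀ s ∈ U, M s ≠ 0) (hP : DifferentiableOn ℂ P V)
    (hexp : ∀ s ∈ V, exp (P s) = M s) :
    ∃ F : ℂ → ℂ, DifferentiableOn ℂ F U ∧ (∀ s ∈ U, exp (F s) = M s) ∧ ∀ s ∈ V, F s = P s := by
  obtain ⟨G, hGc, hG⟩ := exists_continuousOn_eqOn_exp_comp
    (isSimplyConnected_of_convex hUc (hVne.mono hVU)) hU hM.continuousOn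
    (by rintro ⟨s, hs, h⟩; exact hM0 s hs h)
  have hGe : ∀ s ∈ U, exp (G s) = M s := fun s hs => hG hs
  have hGd := differentiableOn_of_exp_eq hU hM hGc hGe
  have hderiv {Q : ℂ → ℂ} (hQ : DifferentiableOn ℂ Q V) (hQe : ∀ s ∈ V, exp (Q s) = M s) {s : ℂ}
      (hs : s ∈ V) : M s * deriv Q s = deriv M s := by
    have h1 := (hQ.differentiableAt (hV.mem_nhds hs)).hasDerivAt.cexp
    have h2 : M =ᶠ[𝓝 s] fun x => exp (Q x) := by
      filter_upwards [hV.mem_nhds hs] with x hx using (hQe x hx).symm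
    rw [h2.deriv_eq, h1.deriv, hQe s hs]
  obtain ⟨a, ha⟩ := hV.exists_is_const_of_deriv_eq_zero hVc ((hGd.mono hVU).sub hP) (by
    intro s hs
    have h1 := hderiv (hGd.mono hVU) (fun s hs => hGe s (hVU hs)) hs
    have h2 := hderiv hP hexp hs
    have h3 := mul_left_cancel₀ (hM0 s (hVU hs)) (h1.trans h2.symm)
    rw [deriv_sub (hGd.differentiableAt (hU.mem_nhds (hVU hs)))
      (hP.differentiableAt (hV.mem_nhds hs)), h3]
    simp)
  have ha1 : exp a = 1 := by
    obtain ⟨s, hs⟩ := hVne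
    rw [← ha s hs, Pi.sub_apply, exp_sub, hGe s (hVU hs), hexp s hs,
      div_self (hM0 s (hVU hs))]
  refine ⟨fun s => G s - a, hGd.sub_const a, fun s hs => ?_, fun s hs => ?_⟩
  · rw [exp_sub, hGe s hs, ha1, div_one]
  · rw [← ha s hs]; simp

/-! ### The logarithm of an Euler product -/

variable {m : ℕ} {c : Fin m → ℕ → ℂ}

/-- The coefficient `∑ j, c_j(p)` of `p ^ (-s)` in `log L`, extended by zero to all integers. -/
noncomputable def primeCoeff (c : Fin m → ℕ → ℂ) (n : ℕ) : ℂ :=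
  if n.Prime then ∑ j, c j n else 0

/-- The contribution to `log L` of the powers `p ^ (-k s)` with `k ≥ 2` of a prime `p`, extended
by zero to all integers. -/
noncomputable def logRemainder (c : Fin m → ℕ → ℂ) (n : ℕ) (s : ℂ) : ℂ :=
  if n.Prime then ∑ j, (-log (1 - c j n * (n : ℂ) ^ (-s)) - c j n * (n : ℂ) ^ (-s)) else 0

lemma norm_primeCoeff_le (hc : ∀ (j : Fin m) (p : ℕ), p.Prime → ‖c j p‖ ≤ 1) (n : ℕ) :
    ‖primeCoeff c n‖ ≤ m := by
  unfold primeCoeff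
  split_ifs with hn
  · exact (norm_sum_le_of_le _ fun j _ => hc j n hn).trans_eq (by simp)
  · simp

lemma norm_coeff_mul_cpow_le (hc : ∀ (j : Fin m) (p : ℕ), p.Prime → ‖c j p‖ ≤ 1) {p : ℕ}
    (hp : p.Prime) (j : Fin m) {s : ℂ} (hs : 1 / 2 ≤ s.re) :
    ‖c j p * (p : ℂ) ^ (-s)‖ ≤ (p : ℝ) ^ (-s.re) ∧ ‖c j p * (p : ℂ) ^ (-s)‖ ≤ 3 / 4 := by
  have h1 : ‖c j p * (p : ℂ) ^ (-s)‖ ≤ (p : ℝ) ^ (-s.re) := by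
    rw [norm_mul, norm_natCast_cpow_of_pos hp.pos, neg_re]
    exact mul_le_of_le_one_left (by positivity) (hc j p hp)
  have hp2 : (2 : ℝ) ≤ p := by exact_mod_cast hp.two_le
  refine ⟨h1, h1.trans ?_⟩
  calc (p : ℝ) ^ (-s.re) ≤ (p : ℝ) ^ (-(1 / 2) : ℝ) :=
        Real.rpow_le_rpow_of_exponent_le (by linarith) (by linarith)
    _ ≤ (2 : ℝ) ^ (-(1 / 2) : ℝ) :=
        Real.rpow_le_rpow_of_nonpos (by norm_num) hp2 (by norm_num)
    _ = √(1 / 2) := by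
        rw [Real.rpow_neg (by norm_num), ← Real.inv_rpow (by norm_num), Real.sqrt_eq_rpow]
        norm_num
    _ ≤ 3 / 4 := by rw [Real.sqrt_le_left (by norm_num)]; norm_num

lemma norm_logRemainder_le (hc : ∀ (j : Fin m) (p : ℕ), p.Prime → ‖c j p‖ ≤ 1) (n : ℕ) {s : ℂ}
    (hs : 1 / 2 ≤ s.re) : ‖logRemainder c n s‖ ≤ 2 * m * (n : ℝ) ^ (-(2 * s.re)) := by
  unfold logRemainder
  split_ifs with hn
  · have hcard : 2 * (m : ℝ) * (n : ℝ) ^ (-(2 * s.re)) =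
        ∑ _j : Fin m, 2 * (n : ℝ) ^ (-(2 * s.re)) := by
      rw [Finset.sum_const, Finset.card_univ, Fintype.card_fin, nsmul_eq_mul]; ring
    rw [hcard]
    refine norm_sum_le_of_le _ fun j _ => ?_
    obtain ⟨h1, h2⟩ := norm_coeff_mul_cpow_le hc hn j hs
    set z := c j n * (n : ℂ) ^ (-s)
    have h3 := norm_log_one_add_sub_self_le (z := -z) (by rw [norm_neg]; linarith)
    rw [norm_neg] at h3
    have h4 : -log (1 - z) - z = -(log (1 + -z) - -z) := by rw [← sub_eq_add_neg]; ring
    have h5 : (1 - ‖z‖)⁻¹ ≤ 4 := by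
      rw [inv_le_comm₀ (by linarith) (by norm_num)]; linarith
    have h6 : (n : ℝ) ^ (-(2 * s.re)) = ((n : ℝ) ^ (-s.re)) ^ 2 := by
      rw [← Real.rpow_natCast, ← Real.rpow_mul (Nat.cast_nonneg n)]; congr 1; push_cast; ring
    rw [h4, norm_neg, h6]
    calc _ ≤ ‖z‖ ^ 2 * (1 - ‖z‖)⁻¹ / 2 := h3
      _ ≤ ‖z‖ ^ 2 * 4 / 2 := by gcongr
      _ = 2 * ‖z‖ ^ 2 := by ring
      _ ≤ _ := by gcongr
  · rw [norm_zero]; positivity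

lemma norm_logRemainder_le_of_le (hc : ∀ (j : Fin m) (p : ℕ), p.Prime → ‖c j p‖ ≤ 1) (n : ℕ)
    {σ : ℝ} (hσ : 1 / 2 < σ) {s : ℂ} (hs : σ ≤ s.re) :
    ‖logRemainder c n s‖ ≤ 2 * m * (n : ℝ) ^ (-(2 * σ)) := by
  refine (norm_logRemainder_le hc n (hσ.le.trans hs)).trans ?_
  rcases n.eq_zero_or_pos with rfl | hn
  · rw [Nat.cast_zero, Real.zero_rpow (by linarith), Real.zero_rpow (by linarith)]
  · gcongr
    exact_mod_cast hn

lemma summable_two_mul_rpow (m : ℕ) {σ : ℝ} (hσ : 1 / 2 < σ) :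
    Summable fun n : ℕ => 2 * (m : ℝ) * (n : ℝ) ^ (-(2 * σ)) :=
  (Real.summable_nat_rpow.2 (by linarith)).mul_left _

lemma differentiableOn_tsum_logRemainder (hc : ∀ (j : Fin m) (p : ℕ), p.Prime → ‖c j p‖ ≤ 1)
    {σ : ℝ} (hσ : 1 / 2 < σ) :
    DifferentiableOn ℂ (fun s => ∑' n, logRemainder c n s) {s | σ < s.re} := by
  refine differentiableOn_tsum_of_summable_norm (summable_two_mul_rpow m hσ) (fun n => ?_)
    (isOpen_lt continuous_const continuous_re)
    (fun n s hs => norm_logRemainder_le_of_le hc n hσ (le_of_lt hs))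
  unfold logRemainder
  split_ifs with hn
  · refine DifferentiableOn.fun_sum fun j _ => ?_
    have hz : Differentiable ℂ fun s : ℂ => c j n * (n : ℂ) ^ (-s) :=
      (differentiable_neg.const_cpow (Or.inl (Nat.cast_ne_zero.2 hn.ne_zero))).const_mul _
    refine (DifferentiableOn.neg (DifferentiableOn.clog
      ((differentiable_const 1).sub hz).differentiableOn fun s hs => ?_)).sub
      hz.differentiableOn
    obtain ⟨-, h2⟩ := norm_coeff_mul_cpow_le hc hn j (s := s) (hσ.le.trans (le_of_lt hs))
    have h3 : 1 + -(c j n * (n : ℂ) ^ (-s)) ∈ slitPlane :=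
      mem_slitPlane_of_norm_lt_one (by rw [norm_neg]; linarith)
    rwa [← sub_eq_add_neg] at h3
  · fun_prop

lemma norm_tsum_logRemainder_le (hc : ∀ (j : Fin m) (p : ℕ), p.Prime → ‖c j p‖ ≤ 1)
    {σ : ℝ} (hσ : 1 / 2 < σ) {s : ℂ} (hs : σ ≤ s.re) :
    ‖∑' n, logRemainder c n s‖ ≤ ∑' n : ℕ, 2 * (m : ℝ) * (n : ℝ) ^ (-(2 * σ)) :=
  tsum_of_norm_bounded (summable_two_mul_rpow m hσ).hasSum
    fun n => norm_logRemainder_le_of_le hc n hσ hs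

lemma summable_logRemainder (hc : ∀ (j : Fin m) (p : ℕ), p.Prime → ‖c j p‖ ≤ 1)
    {s : ℂ} (hs : 1 / 2 < s.re) : Summable fun n => logRemainder c n s :=
  Summable.of_norm_bounded (summable_two_mul_rpow m hs)
    fun n => norm_logRemainder_le_of_le hc n hs le_rfl

lemma localFactor_eq_exp (hc : ∀ (j : Fin m) (p : ℕ), p.Prime → ‖c j p‖ ≤ 1) {p : ℕ}
    (hp : p.Prime) {s : ℂ} (hs : 1 / 2 ≤ s.re) :
    localFactor c p s = exp (primeCoeff c p * (p : ℂ) ^ (-s) + logRemainder c p s) := by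
  rw [primeCoeff, if_pos hp, logRemainder, if_pos hp, Finset.sum_mul, ← Finset.sum_add_distrib,
    exp_sum, localFactor]
  refine Finset.prod_congr rfl fun j _ => ?_
  obtain ⟨-, h2⟩ := norm_coeff_mul_cpow_le hc hp j hs
  have h0 : 1 - c j p * (p : ℂ) ^ (-s) ≠ 0 := by
    intro h
    rw [← sub_eq_zero.1 h, norm_one] at h2
    norm_num at h2
  rw [show c j p * (p : ℂ) ^ (-s) + (-log (1 - c j p * (p : ℂ) ^ (-s)) - c j p * (p : ℂ) ^ (-s)) =
    -log (1 - c j p * (p : ℂ) ^ (-s)) by ring, exp_neg, exp_log h0]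

/-- The Euler product in exponential form. -/
lemma IsEulerProduct.eq_exp {L : ℂ → ℂ} (h : IsEulerProduct c L) {s : ℂ} (hs : 1 < s.re) :
    L s = exp (LSeries (primeCoeff c) s + ∑' n, logRemainder c n s) := by
  have hsum : HasSum (fun n : ℕ => LSeries.term (primeCoeff c) s n + logRemainder c n s)
      (LSeries (primeCoeff c) s + ∑' n, logRemainder c n s) :=
    (LSeriesSummable_of_bounded_of_one_lt_re
      (fun n _ => norm_primeCoeff_le h.1 n) hs).hasSum.add
      (summable_logRemainder h.1 (by linarith)).hasSum
  have hsupp : Function.support (fun n : ℕ => LSeries.term (primeCoeff c) s n +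
      logRemainder c n s) ⊆ {p : ℕ | p.Prime} := by
    intro n hn
    by_contra hp
    rw [mem_ofPred_eq] at hp
    refine hn ?_
    rcases eq_or_ne n 0 with rfl | h0
    · simp [logRemainder, Nat.not_prime_zero]
    · simp [logRemainder, hp, LSeries.term_of_ne_zero h0, primeCoeff]
  have hprod := ((hasSum_subtype_iff_of_support_subset hsupp).2 hsum).cexp
  refine (h.2 s hs).unique (Eq.subst (motive := fun g => HasProd g _) ?_ hprod)
  funext p
  have hp : (p : ℕ).Prime := p.2
  simp only [Function.comp_apply]
  rw [localFactor_eq_exp h.1 hp (by linarith), LSeries.term_of_ne_zero hp.ne_zero, cpow_neg,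
    div_eq_mul_inv]

lemma truncatedProduct_eq_exp (hc : ∀ (j : Fin m) (p : ℕ), p.Prime → ‖c j p‖ ≤ 1) (x : ℝ) :
    truncatedProduct c x 1 = exp (dirichletPoly (primeCoeff c) ⌊x⌋₊ 1 +
      ∑ n ∈ Finset.range (⌊x⌋₊ + 1), logRemainder c n 1) := by
  have h1 : dirichletPoly (primeCoeff c) ⌊x⌋₊ 1 = ∑ n ∈ Finset.range (⌊x⌋₊ + 1),
      primeCoeff c n * (n : ℂ) ^ (-1 : ℂ) := by
    rw [Finset.sum_range_succ']
    simp [dirichletPoly, primeCoeff, Nat.not_prime_zero]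
  rw [h1, ← Finset.sum_add_distrib, exp_sum, truncatedProduct, Finset.prod_filter]
  have : Finset.Iic ⌊x⌋₊ = Finset.range (⌊x⌋₊ + 1) := by ext; simp
  rw [this]
  refine Finset.prod_congr rfl fun n _ => ?_
  split_ifs with hn
  · rw [localFactor_eq_exp hc hn (by norm_num)]
  · simp [primeCoeff, logRemainder, hn]

lemma norm_tsum_logRemainder_tail_le (hc : ∀ (j : Fin m) (p : ℕ), p.Prime → ‖c j p‖ ≤ 1) {X : ℕ}
    (hX : 1 ≤ X) :
    ‖(∑' n, logRemainder c n 1) - ∑ n ∈ Finset.range (X + 1), logRemainder c n 1‖ ≤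
      2 * m / X := by
  have hs := summable_logRemainder hc (s := 1) (by norm_num)
  rw [← hs.sum_add_tsum_nat_add (X + 1), add_sub_cancel_left]
  have h2 := mul_tsum_tail_le (σ := 1) one_pos hX
  have h3 : Summable fun n : ℕ => ((n + (X + 1) : ℕ) : ℝ) ^ (-1 - 1 : ℝ) :=
    (summable_nat_add_iff (f := fun n : ℕ => (n : ℝ) ^ (-1 - 1 : ℝ)) (X + 1)).2
      (summable_rpow_neg_one_sub one_pos)
  refine (tsum_of_norm_bounded (h3.mul_left (2 * (m : ℝ))).hasSum fun n => ?_).trans ?_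
  · refine (norm_logRemainder_le hc _ (by norm_num)).trans_eq ?_
    norm_num
  · rw [tsum_mul_left, div_eq_mul_inv, ← Real.rpow_neg_one]
    gcongr
    linarith

/-! ### Bounds for the continued logarithm -/

/-- The Borel–Carathéodory theorem on the ball of radius `ρ` about `z₀`, with a bound that is
uniform on the smaller ball of radius `r`. -/
lemma norm_le_of_re_le {F : ℂ → ℂ} {z₀ z : ℂ} {ρ r B : ℝ} (hB : 0 < B)
    (hF : DifferentiableOn ℂ F (Metric.ball z₀ ρ)) (hre : ∀ w ∈ Metric.ball z₀ ρ, (F w).re ≤ B)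
    (hr : 0 < r) (hrρ : r < ρ) (hz : ‖z - z₀‖ ≤ r) :
    ‖F z‖ ≤ 2 * B * r / (ρ - r) + ‖F z₀‖ * (ρ + r) / (ρ - r) := by
  have hmaps : MapsTo (fun w : ℂ => z₀ + w) (Metric.ball 0 ρ) (Metric.ball z₀ ρ) := by
    intro w hw
    simpa using hw
  have h := borelCaratheodory (f := fun w => F (z₀ + w)) hB (R := ρ) (z := z - z₀)
    (hF.comp (by fun_prop) hmaps) (fun w hw => hre _ (hmaps hw)) (hr.trans hrρ)
    (by simpa using hz.trans_lt hrρ)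
  simp only [add_sub_cancel, add_zero] at h
  refine h.trans ?_
  have h1 : 0 < ρ - r := by linarith
  have h2 : 0 ≤ ‖F z₀‖ * (ρ + r) := mul_nonneg (norm_nonneg _) (by linarith)
  gcongr

lemma norm_LSeries_le {b : ℕ → ℂ} {m : ℝ} (hm : 0 ≤ m) (hb : ∀ n, ‖b n‖ ≤ m) {w : ℂ}
    (hw : w.re = 1) : ‖LSeries b (1 + w)‖ ≤ 2 * m := by
  -- The tail estimate with `X = 1`, to which the first term is added back.
  have h1 := norm_LSeries_sub_dirichletPoly_mul_le hm hb le_rfl (w := w) (by rw [hw]; exact one_pos)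
  rw [hw] at h1
  have h2 : ‖dirichletPoly b 1 (1 + w)‖ ≤ m := by simpa [dirichletPoly] using hb 1
  have h3 := norm_le_norm_sub_add (LSeries b (1 + w)) (dirichletPoly b 1 (1 + w))
  simp at h1
  linarith

/-- The zero-free region of `L`, translated by one so that the point `s = 1` becomes the origin. -/
def shiftedRegion (δ ℓ : ℝ) : Set ℂ := {w | -(δ / 7) < w.re} ∩ {w | |w.im| < 2 * ℓ ^ 3}

lemma isOpen_shiftedRegion (δ ℓ : ℝ) : IsOpen (shiftedRegion δ ℓ) :=
  (isOpen_lt continuous_const continuous_re).inter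
    (isOpen_lt continuous_im.abs continuous_const)

lemma convex_shiftedRegion (δ ℓ : ℝ) : Convex ℝ (shiftedRegion δ ℓ) := by
  refine (convex_halfSpace_re_gt _).inter ?_
  have : {w : ℂ | |w.im| < 2 * ℓ ^ 3} = {w | -(2 * ℓ ^ 3) < w.im} ∩ {w | w.im < 2 * ℓ ^ 3} := by
    ext w
    change |w.im| < 2 * ℓ ^ 3 ↔ -(2 * ℓ ^ 3) < w.im ∧ w.im < 2 * ℓ ^ 3
    exact abs_lt
  rw [this]
  exact (convex_halfSpace_im_gt _).inter (convex_halfSpace_im_lt _)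

/-- The logarithm of `L` without the prime powers of exponent at least two, continued to the
zero-free region, together with the upper bound for its real part that comes from the growth
of `L`. -/
lemma exists_log_continuation {L : ℂ → ℂ} {δ N σL K γ₁ γ₂ : ℝ} (hδ₀ : 0 < δ) (hδ₁ : δ < 7 / 2)
    (hγ₂ : 0 < γ₂) (hN : 16 ≤ N) (hσL : δ < 7 * (1 - σL)) (hL : IsEulerProduct c L)
    (hLa : AnalyticOnNhd ℂ L {s : ℂ | σL ≤ s.re})
    (hL0 : ∀ s ∈ zeroFreeDomain δ N, L s ≠ 0)
    (hLb : ∀ s : ℂ, σL < s.re → s.re < 4 → ‖L s‖ ≤ K * (N ^ γ₁ * (1 + |s.im|) ^ γ₂)) :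
    ∃ F : ℂ → ℂ, DifferentiableOn ℂ F (shiftedRegion δ (Real.log N)) ∧
      L 1 = exp (F 0 + ∑' n, logRemainder c n 1) ∧
      (∀ w ∈ shiftedRegion δ (Real.log N), 0 < w.re → F w = LSeries (primeCoeff c) (1 + w)) ∧
      ∀ w ∈ shiftedRegion δ (Real.log N), w.re < 3 → (F w).re ≤ Real.log (max K 1) +
        γ₁ * Real.log N + γ₂ * |w.im| + ∑' n : ℕ, 2 * (m : ℝ) * (n : ℝ) ^ (-(2 * (1 - δ / 7))) := by
  have hℓ : 0 < Real.log N := Real.log_pos (by linarith)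
  set ℓ := Real.log N with hℓdef
  set U := shiftedRegion δ ℓ with hU
  have hσ : 1 / 2 < 1 - δ / 7 := by linarith
  set H : ℂ → ℂ := fun s => ∑' n, logRemainder c n s with hH
  have hHd : DifferentiableOn ℂ H {s | 1 - δ / 7 < s.re} :=
    differentiableOn_tsum_logRemainder hL.1 hσ
  set M : ℂ → ℂ := fun w => L (1 + w) * exp (-H (1 + w)) with hM
  have hUre {w : ℂ} (hw : w ∈ U) : 1 - δ / 7 < (1 + w).re := by
    have : -(δ / 7) < w.re := hw.1
    rw [add_re, one_re]; linarith
  have hMd : DifferentiableOn ℂ M U := by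
    refine DifferentiableOn.mul ?_ (DifferentiableOn.cexp (DifferentiableOn.neg ?_))
    · refine hLa.differentiableOn.comp (by fun_prop) fun w hw => ?_
      have := hUre hw
      change σL ≤ (1 + w).re
      linarith
    · exact hHd.comp (by fun_prop) fun w hw => hUre hw
  have hM0 : ∀ w ∈ U, M w ≠ 0 := by
    intro w hw
    refine mul_ne_zero (hL0 _ ?_) (exp_ne_zero _)
    have h1 := hUre hw
    have h2 : |w.im| < 2 * ℓ ^ 3 := hw.2
    rcases le_or_gt 1 (1 + w).re with h | h
    · exact Or.inl h
    · exact Or.inr ⟨h1.le, h, by simpa using h2.le⟩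
  set V : Set ℂ := U ∩ {w | 0 < w.re} with hV
  have hVo : IsOpen V := (isOpen_shiftedRegion δ ℓ).inter
    (isOpen_lt continuous_const continuous_re)
  have hVne : V.Nonempty := by
    refine ⟨1, ⟨?_, ?_⟩, ?_⟩
    · change -(δ / 7) < (1 : ℂ).re
      rw [one_re]; linarith
    · change |(1 : ℂ).im| < 2 * ℓ ^ 3
      rw [one_im, abs_zero]; positivity
    · change 0 < (1 : ℂ).re
      simp
  have hP : DifferentiableOn ℂ (fun w => LSeries (primeCoeff c) (1 + w)) V := by
    have hab : LSeries.abscissaOfAbsConv (primeCoeff c) ≤ 1 :=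
      LSeries.abscissaOfAbsConv_le_of_le_const ⟨m, fun n _ => norm_primeCoeff_le hL.1 n⟩
    refine (LSeries_differentiableOn (primeCoeff c)).comp (by fun_prop) fun w hw => ?_
    have h0 : 0 < w.re := hw.2
    refine hab.trans_lt ?_
    have : (1 : ℝ) < (1 + w).re := by rw [add_re, one_re]; linarith
    exact_mod_cast this
  have hexp : ∀ w ∈ V, exp (LSeries (primeCoeff c) (1 + w)) = M w := by
    intro w hw
    have h0 : 0 < w.re := hw.2
    have : 1 < (1 + w).re := by rw [add_re, one_re]; linarith
    simp only [hM]
    rw [hL.eq_exp this, exp_add, mul_assoc, ← exp_add]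
    simp [hH]
  obtain ⟨F, hFd, hFe, hFP⟩ := exists_log_extension (isOpen_shiftedRegion δ ℓ)
    (convex_shiftedRegion δ ℓ) hVo
    (((convex_shiftedRegion δ ℓ).inter (convex_halfSpace_re_gt 0)).isPreconnected)
    hVne inter_subset_left hMd hM0 hP hexp
  refine ⟨F, hFd, ?_, fun w hw h0 => hFP w ⟨hw, h0⟩, fun w hw h3 => ?_⟩
  · have h0 : (0 : ℂ) ∈ U := by
      refine ⟨?_, ?_⟩
      · change -(δ / 7) < (0 : ℂ).re
        rw [zero_re]; linarith
      · change |(0 : ℂ).im| < 2 * ℓ ^ 3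
        rw [zero_im, abs_zero]; positivity
    have := hFe 0 h0
    simp only [hM, add_zero] at this
    rw [exp_add, this, mul_assoc, ← exp_add]
    simp [hH]
  · have h1 := hUre hw
    have hH1 := norm_tsum_logRemainder_le hL.1 hσ h1.le
    set CH := ∑' n : ℕ, 2 * (m : ℝ) * (n : ℝ) ^ (-(2 * (1 - δ / 7)))
    have hK : 0 < max K 1 := lt_max_of_lt_right one_pos
    have hLw := hLb (1 + w) (by linarith) (by rw [add_re, one_re]; linarith)
    have him : (1 + w).im = w.im := by simp
    rw [him] at hLw
    have hN0 : 0 < N := by linarith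
    have hpow : (1 + |w.im|) ^ γ₂ ≤ Real.exp (γ₂ * |w.im|) := by
      rw [mul_comm, Real.exp_mul]
      refine Real.rpow_le_rpow (by positivity) ?_ hγ₂.le
      linarith [Real.add_one_le_exp |w.im|]
    have hNp : N ^ γ₁ = Real.exp (γ₁ * ℓ) := by
      rw [Real.rpow_def_of_pos hN0, mul_comm]
    have hEH : ‖exp (-H (1 + w))‖ ≤ Real.exp CH :=
      (norm_exp_le_exp_norm _).trans (Real.exp_le_exp.2 (by rw [norm_neg]; exact hH1))
    have : Real.exp (F w).re ≤ Real.exp (Real.log (max K 1) + γ₁ * ℓ + γ₂ * |w.im| + CH) := by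
      rw [← norm_exp, hFe w hw]
      simp only [hM]
      rw [norm_mul, Real.exp_add, Real.exp_add, Real.exp_add, Real.exp_log hK, ← hNp]
      refine mul_le_mul (hLw.trans ?_) hEH (norm_nonneg _) (by positivity)
      rw [mul_assoc]
      have : 0 ≤ N ^ γ₁ * (1 + |w.im|) ^ γ₂ := by positivity
      calc _ ≤ max K 1 * (N ^ γ₁ * (1 + |w.im|) ^ γ₂) := by gcongr; exact le_max_left _ _
        _ ≤ _ := by gcongr
    exact Real.exp_le_exp.1 this

lemma two_le_log {N : ℝ} (hN : 16 ≤ N) : 2 ≤ Real.log N := by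
  have h1 : Real.log 16 = 4 * Real.log 2 := by
    rw [show (16 : ℝ) = 2 ^ 4 by norm_num, Real.log_pow]; norm_num
  have h2 := Real.log_le_log (by norm_num) hN
  linarith [Real.log_two_gt_d9]

/-- In the strip `-δ / 8 ≤ Re w ≤ 0`, `|Im w| ≤ ℓ` the continued logarithm is `O(ℓ)`, by the
Borel–Carathéodory theorem on the ball of radius `1 + δ / 7` about `1 + i Im w`. -/
lemma norm_log_continuation_le {F : ℂ → ℂ} {δ ℓ C : ℝ} (hδ₀ : 0 < δ) (hδ₁ : δ < 7 / 2)
    (hℓ : 2 ≤ ℓ) (hC : 0 < C) (hc : ∀ (j : Fin m) (p : ℕ), p.Prime → ‖c j p‖ ≤ 1)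
    (hFd : DifferentiableOn ℂ F (shiftedRegion δ ℓ))
    (hFL : ∀ w ∈ shiftedRegion δ ℓ, 0 < w.re → F w = LSeries (primeCoeff c) (1 + w))
    (hFre : ∀ w ∈ shiftedRegion δ ℓ, w.re < 3 → |w.im| ≤ 2 * ℓ → (F w).re ≤ C * ℓ)
    {w : ℂ} (hw1 : -(δ / 8) ≤ w.re) (hw2 : w.re ≤ 0) (hw3 : |w.im| ≤ ℓ) :
    ‖F w‖ ≤ (224 * C + 448 * m) / δ * ℓ := by
  have hℓ3 : 2 * ℓ < 2 * ℓ ^ 3 := by nlinarith [sq_nonneg ℓ, sq_nonneg (ℓ - 1)]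
  -- In the variable `s` this is the point `2 + i t`, where the Dirichlet series converges absolutely.
  set z₀ : ℂ := ⟨1, w.im⟩ with hz₀
  have hball : ∀ v ∈ Metric.ball z₀ (1 + δ / 7),
      v ∈ shiftedRegion δ ℓ ∧ v.re < 3 ∧ |v.im| ≤ 2 * ℓ := by
    intro v hv
    rw [Metric.mem_ball, dist_eq_norm] at hv
    have h1 := abs_lt.1 ((abs_re_le_norm _).trans_lt hv)
    have h2 := (abs_im_le_norm _).trans_lt hv
    simp only [hz₀, sub_re, sub_im] at h1 h2
    have h3 : |v.im| ≤ 2 * ℓ := by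
      have := abs_sub_abs_le_abs_sub v.im w.im
      linarith
    exact ⟨⟨by change -(δ / 7) < v.re; linarith [h1.1], by change |v.im| < _; linarith⟩,
      by linarith [h1.2], h3⟩
  have hz₀mem : z₀ ∈ shiftedRegion δ ℓ := (hball z₀ (Metric.mem_ball_self (by positivity))).1
  have hF0 : ‖F z₀‖ ≤ 2 * m := by
    rw [hFL z₀ hz₀mem (by simp [hz₀])]
    exact norm_LSeries_le (Nat.cast_nonneg m) (norm_primeCoeff_le hc) rfl
  have hdist : ‖w - z₀‖ ≤ 1 + δ / 8 := by
    have : w - z₀ = ((w.re - 1 : ℝ) : ℂ) := by apply Complex.ext <;> simp [hz₀]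
    rw [this, norm_real, Real.norm_eq_abs, abs_le]
    constructor <;> linarith
  have h := norm_le_of_re_le (F := F) (z₀ := z₀) (z := w) (ρ := 1 + δ / 7) (r := 1 + δ / 8)
    (B := C * ℓ) (by positivity) (hFd.mono fun v hv => (hball v hv).1)
    (fun v hv => hFre v (hball v hv).1 (hball v hv).2.1 (hball v hv).2.2) (by positivity)
    (by linarith) hdist
  refine h.trans ?_
  rw [show 1 + δ / 7 - (1 + δ / 8) = δ / 56 by ring, ← add_div, div_mul_eq_mul_div,
    div_le_div_iff₀ (by positivity) hδ₀]
  have hCl : 0 < C * ℓ := by positivity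
  have hml : (m : ℝ) ≤ m * ℓ := le_mul_of_one_le_right (Nat.cast_nonneg m) (by linarith)
  have h1 : 2 * (C * ℓ) * (1 + δ / 8) ≤ 4 * (C * ℓ) := by nlinarith
  have h2 : ‖F z₀‖ * (1 + δ / 7 + (1 + δ / 8)) ≤ 2 * m * 4 := by
    gcongr; linarith
  have h3 : 2 * (C * ℓ) * (1 + δ / 8) + ‖F z₀‖ * (1 + δ / 7 + (1 + δ / 8)) ≤
      4 * (C * ℓ) + 8 * (m * ℓ) := by linarith
  calc _ ≤ (4 * (C * ℓ) + 8 * (m * ℓ)) * δ := by gcongr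
    _ = _ := by ring

/-- With `R = ℓ ^ (3 / 5)`, `κ = δ / 8` and `X = ⌊ℓ ^ A⌋`, all the error terms of the contour
argument are `O(ℓ ^ (-3 / 20))`. -/
lemma error_terms_le {δ A ℓ μ C : ℝ} (hδ₀ : 0 < δ) (hδ₁ : δ < 7 / 2) (hA : 14 / δ ≤ A)
    (hℓ : 1 ≤ ℓ) (hμ : 0 ≤ μ) (hC : 0 ≤ C) :
    20 * μ / ℓ ^ (3 / 5 : ℝ) + 10 * μ / ⌊ℓ ^ A⌋₊ +
        4 * (C * ℓ) * (δ / 8) ^ 2 / (ℓ ^ (3 / 5 : ℝ)) ^ 2 +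
        C * ℓ * (⌊ℓ ^ A⌋₊ : ℝ) ^ (-(δ / 8)) * (2 * ℓ ^ (3 / 5 : ℝ) / (δ / 8) + 4) +
        2 * μ / ⌊ℓ ^ A⌋₊ ≤
      (44 * μ + 4 * C * (δ / 8) ^ 2 + 2 * C * (2 / (δ / 8) + 4)) * ℓ ^ (-(3 / 20) : ℝ) := by
  have hℓ0 : 0 < ℓ := by linarith
  have hA4 : 4 < A := by
    refine lt_of_lt_of_le ?_ hA
    rw [lt_div_iff₀ hδ₀]; linarith
  have hAδ : 7 / 4 ≤ A * (δ / 8) := by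
    rw [div_le_iff₀ hδ₀] at hA; linarith
  set κ := δ / 8 with hκ
  have hκ0 : 0 < κ := by positivity
  have hκ1 : κ ≤ 1 := by rw [hκ]; linarith
  set e := ℓ ^ (-(3 / 20) : ℝ) with he
  set y := ℓ ^ A with hy
  have hy1 : 1 ≤ y := Real.one_le_rpow hℓ (by linarith)
  set X : ℝ := (⌊y⌋₊ : ℝ) with hX
  -- Rounding `y` down to an integer costs at most a factor two.
  have hXy : y / 2 ≤ X := by
    have h1 := Nat.lt_floor_add_one y
    have h2 : (1 : ℝ) ≤ ⌊y⌋₊ := by exact_mod_cast (Nat.one_le_floor_iff y).2 hy1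
    rw [hX]; linarith
  have hX0 : 0 < X := by linarith
  have hle {a b : ℝ} (hab : a ≤ b) : ℓ ^ a ≤ ℓ ^ b := Real.rpow_le_rpow_of_exponent_le hℓ hab
  have t1 : 1 / ℓ ^ (3 / 5 : ℝ) ≤ e := by
    rw [one_div, ← Real.rpow_neg hℓ0.le]; exact hle (by norm_num)
  have t2 : 1 / X ≤ 2 * e := by
    have : 1 / X ≤ 1 / (y / 2) := one_div_le_one_div_of_le (by linarith) hXy
    refine this.trans ?_
    have h1 : 1 / (y / 2) = 2 * ℓ ^ (-A) := by rw [Real.rpow_neg hℓ0.le]; field_simp; rfl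
    rw [h1]
    have := hle (show -A ≤ -(3 / 20) by linarith)
    linarith
  have t3 : ℓ / (ℓ ^ (3 / 5 : ℝ)) ^ 2 ≤ e := by
    have h1 : ℓ / (ℓ ^ (3 / 5 : ℝ)) ^ 2 = ℓ ^ (-(1 / 5) : ℝ) := by
      nth_rewrite 1 [← Real.rpow_one ℓ]
      rw [← Real.rpow_natCast, ← Real.rpow_mul hℓ0.le, ← Real.rpow_sub hℓ0]
      norm_num
    rw [h1]; exact hle (by norm_num)
  have t4 : X ^ (-κ) ≤ 2 * ℓ ^ (-(7 / 4) : ℝ) := by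
    have h1 : X ^ (-κ) ≤ (y / 2) ^ (-κ) :=
      Real.rpow_le_rpow_of_nonpos (by linarith) hXy (by linarith)
    have h2 : (y / 2) ^ (-κ) = 2 ^ κ * ℓ ^ (-(A * κ)) := by
      rw [Real.div_rpow (by linarith) (by norm_num), hy, ← Real.rpow_mul hℓ0.le,
        Real.rpow_neg (by norm_num) κ, div_inv_eq_mul, mul_comm, mul_neg]
    have h3 : (2 : ℝ) ^ κ ≤ 2 := by
      simpa using Real.rpow_le_rpow_of_exponent_le (x := 2) (by norm_num) hκ1
    rw [h2] at h1
    refine h1.trans (mul_le_mul h3 (hle (by linarith)) (by positivity) (by norm_num))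
  have hR1 : 1 ≤ ℓ ^ (3 / 5 : ℝ) := Real.one_le_rpow hℓ (by norm_num)
  have t5 : ℓ * X ^ (-κ) * (2 * ℓ ^ (3 / 5 : ℝ) / κ + 4) ≤ 2 * (2 / κ + 4) * e := by
    have h1 : ℓ * ℓ ^ (-(7 / 4) : ℝ) * ℓ ^ (3 / 5 : ℝ) = e := by
      nth_rewrite 1 [← Real.rpow_one ℓ]
      rw [← Real.rpow_add hℓ0, ← Real.rpow_add hℓ0]; norm_num [he]
    have h2 : 2 * ℓ ^ (3 / 5 : ℝ) / κ + 4 ≤ (2 / κ + 4) * ℓ ^ (3 / 5 : ℝ) := by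
      have : 2 * ℓ ^ (3 / 5 : ℝ) / κ = 2 / κ * ℓ ^ (3 / 5 : ℝ) := by ring
      rw [this]; linarith
    calc _ ≤ ℓ * (2 * ℓ ^ (-(7 / 4) : ℝ)) * ((2 / κ + 4) * ℓ ^ (3 / 5 : ℝ)) := by gcongr
      _ = 2 * (2 / κ + 4) * (ℓ * ℓ ^ (-(7 / 4) : ℝ) * ℓ ^ (3 / 5 : ℝ)) := by ring
      _ = _ := by rw [h1]
  calc _ = 20 * μ * (1 / ℓ ^ (3 / 5 : ℝ)) + 12 * μ * (1 / X) +
        4 * C * κ ^ 2 * (ℓ / (ℓ ^ (3 / 5 : ℝ)) ^ 2) +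
        C * (ℓ * X ^ (-κ) * (2 * ℓ ^ (3 / 5 : ℝ) / κ + 4)) := by ring
    _ ≤ 20 * μ * e + 12 * μ * (2 * e) + 4 * C * κ ^ 2 * e + C * (2 * (2 / κ + 4) * e) := by gcongr
    _ = _ := by ring

end EulerTrunc

/-! ### The truncated Euler product at `s = 1` -/

theorem theorem1 (m : ℕ) (hm : 0 < m) (γ₁ γ₂ : ℝ) (hγ₁ : 0 < γ₁) (hγ₂ : 0 < γ₂) (K : ℝ)
    (δ A : ℝ) (hδ₀ : 0 < δ) (hδ₁ : δ < 7 / 2) (hA : 14 / δ ≤ A) :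
    ∃ C : ℝ, ∀ (N : ℝ) (σL : ℝ) (c : Fin m → ℕ → ℂ) (L : ℂ → ℂ),
      16 ≤ N →
      1 / 2 ≤ σL → σL < 1 → δ < 7 * (1 - σL) →
      EulerTrunc.IsEulerProduct c L →
      AnalyticOnNhd ℂ L {s : ℂ | σL ≤ s.re} →
      (∀ s ∈ EulerTrunc.zeroFreeDomain δ N, L s ≠ 0) →
      (∀ s : ℂ, σL < s.re → s.re < 4 → ‖L s‖ ≤ K * (N ^ γ₁ * (1 + |s.im|) ^ γ₂)) →
      ∃ E : ℂ, ‖E‖ ≤ C / Real.log (Real.log N) ∧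
        L 1 = (1 + E) * EulerTrunc.truncatedProduct c ((Real.log N) ^ A) 1 := by
  set CH : ℝ := ∑' n : ℕ, 2 * (m : ℝ) * (n : ℝ) ^ (-(2 * (1 - δ / 7))) with hCH
  have hCH0 : 0 ≤ CH := tsum_nonneg fun n => by positivity
  have hK0 : 0 ≤ Real.log (max K 1) := Real.log_nonneg (le_max_right _ _)
  set CM : ℝ := Real.log (max K 1) + γ₁ + 2 * γ₂ + CH with hCM
  have hCM0 : 0 < CM := by positivity
  set CB : ℝ := (224 * CM + 448 * m) / δ with hCB
  have hCB0 : 0 ≤ CB := by positivity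
  set CZ : ℝ := 44 * m + 4 * CB * (δ / 8) ^ 2 + 2 * CB * (2 / (δ / 8) + 4) with hCZ
  have hCZ0 : 0 ≤ CZ := by positivity
  refine ⟨CZ * Real.exp CZ * (20 / 3), fun N σL c L hN _ _ hσL hL hLa hL0 hLb => ?_⟩
  obtain ⟨F, hFd, hF1, hFL, hFre⟩ :=
    EulerTrunc.exists_log_continuation hδ₀ hδ₁ hγ₂ hN hσL hL hLa hL0 hLb
  have hℓ := EulerTrunc.two_le_log hN
  set ℓ := Real.log N
  have hℓ1 : 1 ≤ ℓ := by linarith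
  have hℓ0 : 0 < ℓ := by linarith
  set R : ℝ := ℓ ^ (3 / 5 : ℝ) with hR
  have hR1 : 1 ≤ R := Real.one_le_rpow hℓ1 (by norm_num)
  have hRℓ : R ≤ ℓ := by
    simpa using Real.rpow_le_rpow_of_exponent_le hℓ1 (show (3 / 5 : ℝ) ≤ 1 by norm_num)
  have hrect : ∀ w ∈ EulerTrunc.rect (δ / 8) R, w ∈ EulerTrunc.shiftedRegion δ ℓ := by
    intro w hw
    rw [EulerTrunc.mem_rect] at hw
    refine ⟨?_, ?_⟩
    · change -(δ / 7) < w.re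
      linarith [hw.1.1]
    · change |w.im| < 2 * ℓ ^ 3
      have : |w.im| ≤ R := abs_le.2 hw.2
      nlinarith [sq_nonneg ℓ, sq_nonneg (ℓ - 1)]
  have hFB : ∀ w ∈ EulerTrunc.rect (δ / 8) R, w.re ≤ 0 → ‖F w‖ ≤ CB * ℓ := by
    intro w hw h0
    rw [EulerTrunc.mem_rect] at hw
    refine EulerTrunc.norm_log_continuation_le hδ₀ hδ₁ hℓ hCM0 hL.1 hFd hFL (fun v hv h3 hv2 => ?_)
      hw.1.1 h0 ((abs_le.2 hw.2).trans hRℓ)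
    refine (hFre v hv h3).trans ?_
    have h1 : γ₂ * |v.im| ≤ γ₂ * (2 * ℓ) := by gcongr
    nlinarith
  set X : ℕ := ⌊ℓ ^ A⌋₊ with hX
  have hA0 : 0 ≤ A := le_trans (by positivity) hA
  have hX1 : 1 ≤ X := (Nat.one_le_floor_iff _).2 (Real.one_le_rpow hℓ1 hA0)
  have hnewman := EulerTrunc.norm_sub_dirichletPoly_le (X := X) (Nat.cast_nonneg m)
    (EulerTrunc.norm_primeCoeff_le hL.1) (κ := δ / 8) (R := R) (B := CB * ℓ) (by positivity)
    (by linarith) (by positivity) hX1 (hFd.mono hrect) (fun w hw h0 => hFL w (hrect w hw) h0) hFB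
  have htail := EulerTrunc.norm_tsum_logRemainder_tail_le hL.1 hX1
  have herr := EulerTrunc.error_terms_le hδ₀ hδ₁ hA hℓ1 (Nat.cast_nonneg m) hCB0
  set Z : ℂ := (F 0 - EulerTrunc.dirichletPoly (EulerTrunc.primeCoeff c) X 1) +
    ((∑' n, EulerTrunc.logRemainder c n 1) -
      ∑ n ∈ Finset.range (X + 1), EulerTrunc.logRemainder c n 1) with hZ
  have hZle : ‖Z‖ ≤ CZ * ℓ ^ (-(3 / 20) : ℝ) :=
    (norm_add_le_of_le hnewman htail).trans herr
  have hZ1 : ‖Z‖ ≤ CZ := hZle.trans (mul_le_of_le_one_right hCZ0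
    (Real.rpow_le_one_of_one_le_of_nonpos hℓ1 (by norm_num)))
  refine ⟨Complex.exp Z - 1, ?_, ?_⟩
  · have h1 : ‖Complex.exp Z - 1‖ ≤ ‖Z‖ * Real.exp ‖Z‖ := by
      simpa using Complex.norm_exp_sub_sum_le_norm_mul_exp Z 1
    have hlog : 0 < Real.log ℓ := Real.log_pos (by linarith)
    have h2 : Real.log ℓ ≤ ℓ ^ (3 / 20 : ℝ) / (3 / 20) :=
      Real.log_le_rpow_div hℓ0.le (by norm_num)
    have h3 : ℓ ^ (-(3 / 20) : ℝ) ≤ 20 / 3 / Real.log ℓ := by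
      rw [Real.rpow_neg hℓ0.le, le_div_iff₀ hlog, inv_mul_le_iff₀ (by positivity)]
      linarith
    calc ‖Complex.exp Z - 1‖ ≤ ‖Z‖ * Real.exp ‖Z‖ := h1
      _ ≤ (CZ * ℓ ^ (-(3 / 20) : ℝ)) * Real.exp CZ := by gcongr
      _ ≤ (CZ * (20 / 3 / Real.log ℓ)) * Real.exp CZ := by gcongr
      _ = _ := by ring
  · rw [hF1, EulerTrunc.truncatedProduct_eq_exp hL.1, add_sub_cancel, ← Complex.exp_add]
    congr 1
    rw [hZ, hX]; ring
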